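/- Let $T, M, N\ge 1$ be integers with $M\le T$, and let $\rho>0$. Consider the block-fading channel $\mathbf X=\sqrt{\rho T/M}\,\mathbf\Phi\mathbf H+\mathbf W$, where $\mathbf\Phi$ is a $T\times M$ random matrix, $\mathbf H$ is $M\times N$, $\mathbf W$ is $T\times N$, the three are independent, and $\mathbf H,\mathbf W$ have independent $\mathcal{CN}(0,1)$ entries. Let $I(\mathbf X;\mathbf\Phi)$ be the mutual information in bits (the Kullback–Leibler divergence of the joint law of $(\mathbf\Phi,\mathbf X)$ from the product of its marginals). Let $\hat I_{USTM}(T,M,N,\rho)=I(\mathbf X;\mathbf\Phi)/T$ when $\mathbf\Phi$ is isotropically distributed on the $T\times M$ matrices with orthonormal columns, i.e. $\mathbf\Phi$ consists of the first $M$ columns of a Haar distributed $T\times T$ unitary matrix. Let $\hat I_{DUSTM}(M,N,\rho)=I(\mathbf X;\mathbf\Phi)/M$ when $T=2M$ and $\mathbf\Phi=\frac1{\sqrt2}\begin{bmatrix}\mathbf I_M\\ \mathbf U\end{bmatrix}$ with $\mathbf U$ Haar distributed in $U(M)$. All these mutual informations are finite, and the following hold. 1. For fixed $T,M,N$ with $1\le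 M\le T$, as $\rho\to0^+$, $$\hat I_{USTM}(T,M,N,\rho)=\frac{N\rho^2}{2M}(T-M)\left[1-\frac{2\rho T}{3M}\left(1+\frac MT\right)\right]\log_2 e+O(\rho^4),$$ and for $T=2M$ the main term on the right equals $\frac{\rho^2N}{2}(1-2\rho)\log_2 e$. 2. For fixed $M,N$, as $\rho\to0^+$, $\hat I_{DUSTM}(M,N,\rho)=2\,\hat I_{USTM}(2M,M,N,\rho)+O(\rho^4)$; that is, the expansions of the two sides agree through order $\rho^3$. 3. For fixed $T,N$ there is $\rho_0>0$ such that for all $0<\rho<\rho_0$ the function $M\mapsto\hat I_{USTM}(T,M,N,\rho)$ is strictly decreasing on $\{1,\dots,T\}$; in particular the unique optimal number of transmit antennas is $M=1$. (The implied constants may depend on $T,M,N$.) -/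

import Mathlib

open MeasureTheory ProbabilityTheory Filter Topology Asymptotics

namespace USTM

/-- Matrices carry the product sigma-algebra of their entries (which is the Borel one). -/
noncomputable instance instMeasurableSpaceMatrix {m n : Type*} : MeasurableSpace (Matrix m n ℂ) :=
  inferInstanceAs (MeasurableSpace (m → n → ℂ))

instance instBorelSpaceMatrix {m n : Type*} [Fintype m] [Fintype n] :
    BorelSpace (Matrix m n ℂ) :=
  inferInstanceAs (BorelSpace (m → n → ℂ))

/-- The unitary group is compact: it is closed, and its entries have modulus at most one. -/
instance instCompactSpaceUnitaryGroup {n : Type*} [Fintype n] [DecidableEq n] :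
    CompactSpace (Matrix.unitaryGroup n ℂ) := by
  refine isCompact_iff_compactSpace.mp ?_
  have hK : IsCompact (Set.pi Set.univ fun _ : n => Set.pi Set.univ fun _ : n =>
      Metric.closedBall (0 : ℂ) 1) :=
    isCompact_univ_pi fun _ => isCompact_univ_pi fun _ => isCompact_closedBall _ _
  refine IsCompact.of_isClosed_subset (X := Matrix n n ℂ) hK
    (isClosed_unitary (R := Matrix n n ℂ)) ?_
  intro U hU i _ j _
  simpa using entry_norm_bound_of_unitary hU i j

/-- Normalized Haar measure on the unitary group `U(n)`. -/
noncomputable def haarUnitary (n : ℕ) : Measure (Matrix.unitaryGroup (Fin n) ℂ) :=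
  Measure.haarMeasure ⊤

/-- The law `CN(0,1)`: independent real and imaginary parts, each `N(0,1/2)`. -/
noncomputable def stdComplexGaussian : Measure ℂ :=
  ((gaussianReal 0 (1 / 2)).prod (gaussianReal 0 (1 / 2))).map
    fun p : ℝ × ℝ => (p.1 : ℂ) + (p.2 : ℂ) * Complex.I

/-- The law of a random matrix whose entries are independent and `CN(0,1)`-distributed. -/
noncomputable def gaussianMatrix (m n : Type*) [Fintype m] [Fintype n] :
    Measure (Matrix m n ℂ) :=
  Measure.pi fun _ : m => Measure.pi fun _ : n => stdComplexGaussian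

/-- The received signal `X = √(ρ T / M) Φ H + W`, where `Φ` is the `T × M` transmitted signal
(`T` is the number of elements of `τ`, `M` that of `μ`). -/
noncomputable def received {τ μ ν : Type*} [Fintype τ] [Fintype μ] (ρ : ℝ)
    (Φ : Matrix τ μ ℂ) (H : Matrix μ ν ℂ) (W : Matrix τ ν ℂ) : Matrix τ ν ℂ :=
  ((Real.sqrt (ρ * (Fintype.card τ : ℝ) / (Fintype.card μ : ℝ)) : ℝ) : ℂ) • (Φ * H) + W

/-- The joint law of `(Φ, X)` when `Φ` has law `P`, and `Φ`, `H`, `W` are independent with `H`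
and `W` having independent `CN(0,1)` entries. -/
noncomputable def jointLaw {τ μ ν : Type*} [Fintype τ] [Fintype μ] [Fintype ν] (ρ : ℝ)
    (P : Measure (Matrix τ μ ℂ)) : Measure (Matrix τ μ ℂ × Matrix τ ν ℂ) :=
  (P.prod ((gaussianMatrix μ ν).prod (gaussianMatrix τ ν))).map
    fun q => (q.1, received ρ q.1 q.2.1 q.2.2)

/-- Mutual information, in nats and as an extended nonnegative number, of a pair with joint law
`J`: the Kullback-Leibler divergence of `J` from the product of its marginals. -/
noncomputable def mutualInfo {α β : Type*} [MeasurableSpace α] [MeasurableSpace β]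
    (J : Measure (α × β)) : ENNReal :=
  InformationTheory.klDiv J (J.fst.prod J.snd)

/-- The `T × M` matrix `[I_M ; 0]`. -/
def stiefelBase (T M : ℕ) : Matrix (Fin T) (Fin M) ℂ :=
  Matrix.of fun i j => if (i : ℕ) = (j : ℕ) then 1 else 0

/-- The isotropic input law on the Stiefel manifold of `T × M` matrices with orthonormal columns
(`M ≤ T`): the law of the first `M` columns of a Haar distributed `T × T` unitary matrix. -/
noncomputable def ustmInput (T M : ℕ) : Measure (Matrix (Fin T) (Fin M) ℂ) :=
  (haarUnitary T).map fun U : Matrix.unitaryGroup (Fin T) ℂ =>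
    (U : Matrix (Fin T) (Fin T) ℂ) * stiefelBase T M

/-- The differential input law, `Φ = (1/√2) [I_M ; U]` with `U` Haar distributed in `U(M)`; there
are `2 M` time intervals, indexed by two copies of `Fin M`. -/
noncomputable def dustmInput (M : ℕ) : Measure (Matrix (Fin M ⊕ Fin M) (Fin M) ℂ) :=
  (haarUnitary M).map fun U : Matrix.unitaryGroup (Fin M) ℂ =>
    (((Real.sqrt 2)⁻¹ : ℝ) : ℂ) •
      Matrix.fromRows (1 : Matrix (Fin M) (Fin M) ℂ) (U : Matrix (Fin M) (Fin M) ℂ)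

/-- Mutual information (in nats) between input and output for USTM. -/
noncomputable def ustmInfo (T M N : ℕ) (ρ : ℝ) : ENNReal :=
  mutualInfo (jointLaw (ν := Fin N) ρ (ustmInput T M))

/-- Mutual information (in nats) between input and output for DUSTM, with `T = 2 M`. -/
noncomputable def dustmInfo (M N : ℕ) (ρ : ℝ) : ENNReal :=
  mutualInfo (jointLaw (ν := Fin N) ρ (dustmInput M))

/-- `log₂ e`, the number of bits in a nat. -/
noncomputable def log2e : ℝ := Real.logb 2 (Real.exp 1)

/-- Normalized USTM mutual information `I / T`, in bits. -/
noncomputable def ustmRate (T M N : ℕ) (ρ : ℝ) : ℝ :=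
  (ustmInfo T M N ρ).toReal * log2e / T

/-- Normalized DUSTM mutual information `I / M`, in bits. -/
noncomputable def dustmRate (M N : ℕ) (ρ : ℝ) : ℝ :=
  (dustmInfo M N ρ).toReal * log2e / M

/-- The low-SNR approximation
`(N ρ² / (2 M)) (T - M) [1 - (2 ρ T / (3 M)) (1 + M / T)] log₂ e`. -/
noncomputable def ustmLowSNR (T M N : ℕ) (ρ : ℝ) : ℝ :=
  (N : ℝ) * ρ ^ 2 / (2 * M) * ((T : ℝ) - M) *
    (1 - 2 * ρ * T / (3 * M) * (1 + (M : ℝ) / T)) * log2e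

end USTM

/-! Put `s = ρT/M`, `K = MN`, `κ = M/T`, and use the law of the noise as reference measure. Given
`Φ` with orthonormal columns, the received signal has density `L = exp(s/(1+s)·|Φᴴx|²)/(1+s)^K`.
Averaging `L` over `Φ` gives the output density `Z`, and the mutual information is `E log L - E log
Z = K(s - log(1+s)) - ∫ Z log Z` (`mutualInfo_jointLaw`). It is finite because `|log Z|` grows at
most linearly in `|x|²`.

For small `s`, write `z = Z - 1` and `w = κ|x|² - K`. If the input satisfies `E|Φᴴx|² = κ|x|²`, then
`z = sw + O(s²)`. In `Z log Z = z + z²/2 - z³/6 + O(z⁴)` one may replace `z³` by `s³w³` and `z²` by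
`2szw - s²w²`, since the latter differs from `z²` by `(z - sw)² = O(s⁴)`. The resulting expression
is linear in `Z`, so its integral is exact once the output energy `E|X|²` and the first three
moments of `|x|²` under the noise law are known. This gives `K(s²(1-κ)/2 - s³(1-κ²)/3) + O(s⁴)`
(`abs_mutualInfo_sub_le`). Fourth-order terms are dominated by a multiple of `exp(|x|²/2)`, which is
integrable under the noise law.

Only the isotropy of the second moment enters. The Haar columns and the differential input both have
it, so at `T = 2M` their mutual informations agree through order three, and the two normalizations
`1/T` and `1/M` produce the factor two. Monotonicity in `M` comes from the quadratic coefficient,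
proportional to `(T-M)/M`. -/

namespace USTM

/-! ### Integrals and densities on finite product spaces. -/

section PiMeasure

variable {ι : Type*} [Fintype ι] {E : ι → Type*} [∀ i, MeasurableSpace (E i)]
  {μ : ∀ i, Measure (E i)} [∀ i, IsProbabilityMeasure (μ i)]

theorem lintegral_pi_prod {f : ∀ i, E i → ENNReal} (hf : ∀ i, Measurable (f i)) :
    ∫⁻ x, ∏ i, f i (x i) ∂Measure.pi μ = ∏ i, ∫⁻ x, f i x ∂μ i := by
  have hind : iIndepFun (fun i (x : ∀ i, E i) => f i (x i)) (Measure.pi μ) :=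
    iIndepFun_pi fun i => (hf i).aemeasurable
  rw [lintegral_prod_eq_prod_lintegral_of_indepFun Finset.univ _ hind
    fun i => (hf i).comp (measurable_pi_apply i)]
  refine Finset.prod_congr rfl fun i _ => ?_
  exact (measurePreserving_eval μ i).lintegral_comp (hf i)

theorem pi_withDensity {f : ∀ i, E i → ENNReal} (hf : ∀ i, Measurable (f i))
    [∀ i, SigmaFinite ((μ i).withDensity (f i))] :
    Measure.pi (fun i => (μ i).withDensity (f i)) =
      (Measure.pi μ).withDensity fun x => ∏ i, f i (x i) := by
  refine Measure.pi_eq fun s hs => ?_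
  rw [withDensity_apply _ (MeasurableSet.univ_pi hs),
    ← lintegral_indicator (MeasurableSet.univ_pi hs)]
  have : (fun x : ∀ i, E i => (Set.univ.pi s).indicator (fun x => ∏ i, f i (x i)) x) =
      fun x => ∏ i, (s i).indicator (f i) (x i) := by
    funext x
    by_cases hx : x ∈ Set.univ.pi s
    · rw [Set.indicator_of_mem hx]
      exact Finset.prod_congr rfl fun i _ => (Set.indicator_of_mem (hx i trivial) _).symm
    · rw [Set.indicator_of_notMem hx]
      simp only [Set.mem_pi, Set.mem_univ, true_imp_iff, not_forall] at hx
      obtain ⟨i, hi⟩ := hx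
      exact (Finset.prod_eq_zero (Finset.mem_univ i) (Set.indicator_of_notMem hi _)).symm
  rw [this, lintegral_pi_prod fun i => (hf i).indicator (hs i)]
  refine Finset.prod_congr rfl fun i _ => ?_
  rw [lintegral_indicator (hs i), withDensity_apply _ (hs i)]

end PiMeasure

/-! ### The scalar complex Gaussian law. -/

section ComplexGaussian

instance isProbabilityMeasure_stdComplexGaussian : IsProbabilityMeasure stdComplexGaussian :=
  Measure.isProbabilityMeasure_map (by fun_prop)

theorem stdComplexGaussian_eq_withDensity :
    stdComplexGaussian =
      volume.withDensity fun z : ℂ => ENNReal.ofReal (Real.pi⁻¹ * Real.exp (-‖z‖ ^ 2)) := by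
  have hv : (1 / 2 : NNReal) ≠ 0 := by norm_num
  have hmap : (fun p : ℝ × ℝ => (p.1 : ℂ) + (p.2 : ℂ) * Complex.I) =
      Complex.measurableEquivRealProd.symm := by
    funext p
    apply Complex.ext <;> simp [Complex.measurableEquivRealProd_symm_apply]
  rw [stdComplexGaussian, gaussianReal_of_var_ne_zero _ hv,
    prod_withDensity (measurable_gaussianPDF _ _) (measurable_gaussianPDF _ _), hmap]
  refine Measure.ext fun s hs => ?_
  rw [Measure.map_apply Complex.measurableEquivRealProd.symm.measurable hs,
    withDensity_apply _ (Complex.measurableEquivRealProd.symm.measurable hs),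
    withDensity_apply _ hs,
    ← (Complex.volume_preserving_equiv_real_prod.symm).setLIntegral_comp_preimage_emb
      Complex.measurableEquivRealProd.symm.measurableEmbedding]
  refine lintegral_congr fun p => ?_
  rw [gaussianPDF, gaussianPDF, ← ENNReal.ofReal_mul (gaussianPDFReal_nonneg _ _ _)]
  congr 1
  have hn : ‖Complex.measurableEquivRealProd.symm p‖ ^ 2 = p.1 ^ 2 + p.2 ^ 2 := by
    rw [← Complex.normSq_eq_norm_sq, Complex.normSq_apply,
      Complex.measurableEquivRealProd_symm_apply]
    ring
  rw [hn, gaussianPDFReal, gaussianPDFReal]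
  have h1 : (2 * Real.pi * ((1 / 2 : NNReal) : ℝ)) = Real.pi := by push_cast; ring
  rw [h1, mul_mul_mul_comm, ← Real.exp_add, ← mul_inv, Real.mul_self_sqrt Real.pi_pos.le]
  congr 2
  push_cast
  ring

/-- The Gaussian weight `exp(-|h|²)` turns `b - 1` into `b`, leaving a two-dimensional Gaussian
integral. The case `b = 1 + s` integrates out a fading coefficient, and `b = 1 - t`, `y = 0` is the
Laplace transform of `|h|²`. -/
theorem lintegral_exp_stdComplexGaussian {b : ℝ} (hb : 0 < b) (c : ℝ) (y : ℂ) :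
    ∫⁻ h, ENNReal.ofReal (Real.exp (2 * c * (inner ℝ y h) - (b - 1) * ‖h‖ ^ 2))
        ∂stdComplexGaussian =
      ENNReal.ofReal (b⁻¹ * Real.exp (c ^ 2 * ‖y‖ ^ 2 / b)) := by
  rw [stdComplexGaussian_eq_withDensity,
    lintegral_withDensity_eq_lintegral_mul _ (by fun_prop) (by fun_prop)]
  have hF : ∀ h : ℂ, Complex.exp (-(b : ℂ) * ‖h‖ ^ 2 + (2 * c : ℝ) * (inner ℝ y h : ℝ)) =
      ((Real.exp (-b * ‖h‖ ^ 2 + 2 * c * inner ℝ y h) : ℝ) : ℂ) := by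
    intro h; push_cast; ring_nf
  have key := GaussianFourier.integral_cexp_neg_mul_sq_norm_add (V := ℂ) (b := (b : ℂ))
    (by simpa using hb) ((2 * c : ℝ) : ℂ) y
  have hint := GaussianFourier.integrable_cexp_neg_mul_sq_norm_add (V := ℂ) (b := (b : ℂ))
    (by simpa using hb) ((2 * c : ℝ) : ℂ) y
  simp_rw [hF] at key hint
  rw [integral_complex_ofReal] at key
  have hint' : Integrable fun h : ℂ => Real.exp (-b * ‖h‖ ^ 2 + 2 * c * inner ℝ y h) := by
    simpa only [RCLike.re_eq_complex_re, Complex.ofReal_re] using hint.re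
  have key' : ∫ h : ℂ, Real.exp (-b * ‖h‖ ^ 2 + 2 * c * inner ℝ y h) =
      Real.pi / b * Real.exp (c ^ 2 * ‖y‖ ^ 2 / b) := by
    apply Complex.ofReal_injective
    rw [key, Complex.finrank_real_complex]
    push_cast
    rw [div_self two_ne_zero, Complex.cpow_one]
    congr 2
    field_simp
    ring
  have : ∀ h : ℂ, ((fun z : ℂ => ENNReal.ofReal (Real.pi⁻¹ * Real.exp (-‖z‖ ^ 2))) * fun h : ℂ =>
      ENNReal.ofReal (Real.exp (2 * c * (inner ℝ y h) - (b - 1) * ‖h‖ ^ 2))) h =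
      ENNReal.ofReal (Real.pi⁻¹ * Real.exp (-b * ‖h‖ ^ 2 + 2 * c * inner ℝ y h)) := by
    intro h
    rw [Pi.mul_apply, ← ENNReal.ofReal_mul (by positivity), mul_assoc, ← Real.exp_add]
    ring_nf
  rw [lintegral_congr this, ← ofReal_integral_eq_lintegral_ofReal (hint'.const_mul _)
    (ae_of_all _ fun _ => by positivity), integral_const_mul, key']
  congr 1
  field_simp

/-- Translation changes the exponent by `|w|² - |w - v|² = 2⟨v, w⟩ - |v|²`. -/
theorem stdComplexGaussian_map_add_right (v : ℂ) :
    stdComplexGaussian.map (fun w => w + v) = stdComplexGaussian.withDensity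
      fun w => ENNReal.ofReal (Real.exp (2 * inner ℝ v w - ‖v‖ ^ 2)) := by
  rw [stdComplexGaussian_eq_withDensity, ← withDensity_mul _ (by fun_prop) (by fun_prop)]
  refine Measure.ext fun s hs => ?_
  have hm : Measurable fun w : ℂ => w + v := by fun_prop
  have key := (measurePreserving_add_right volume v).setLIntegral_comp_preimage_emb
    (MeasurableEquiv.addRight v).measurableEmbedding
    (fun w => ENNReal.ofReal (Real.pi⁻¹ * Real.exp (-‖w - v‖ ^ 2))) s
  simp only [add_sub_cancel_right] at key
  rw [Measure.map_apply hm hs, withDensity_apply _ (hm hs), withDensity_apply _ hs]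
  refine key.trans (lintegral_congr fun w => ?_)
  rw [Pi.mul_apply, ← ENNReal.ofReal_mul (by positivity), mul_assoc, ← Real.exp_add]
  congr 3
  rw [norm_sub_sq_real, real_inner_comm]
  ring

end ComplexGaussian

/-! ### Frobenius norm and real inner product. -/

section MatrixNorm

variable {m n k : Type*} [Fintype m] [Fintype n] [Fintype k]

/-- The squared Frobenius norm. -/
noncomputable def sqNorm (A : Matrix m n ℂ) : ℝ := ∑ i, ∑ j, ‖A i j‖ ^ 2

/-- The real Frobenius inner product. -/
noncomputable def reInner (A B : Matrix m n ℂ) : ℝ := ∑ i, ∑ j, inner ℝ (A i j) (B i j)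

theorem sqNorm_nonneg (A : Matrix m n ℂ) : 0 ≤ sqNorm A :=
  Finset.sum_nonneg fun _ _ => Finset.sum_nonneg fun _ _ => by positivity

theorem measurable_sqNorm :
    Measurable (sqNorm : Matrix m n ℂ → ℝ) := by
  unfold sqNorm
  fun_prop

theorem reInner_eq_trace (A B : Matrix m n ℂ) :
    reInner A B = (A.conjTranspose * B).trace.re := by
  simp only [reInner, Matrix.trace, Matrix.diag, Matrix.mul_apply, Matrix.conjTranspose_apply,
    Complex.re_sum]
  rw [Finset.sum_comm]
  refine Finset.sum_congr rfl fun j _ => Finset.sum_congr rfl fun i _ => ?_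
  rw [Complex.inner]
  simp
  ring

theorem reInner_self (A : Matrix m n ℂ) : reInner A A = sqNorm A := by
  simp only [reInner, sqNorm, real_inner_self_eq_norm_sq]

theorem reInner_comm (A B : Matrix m n ℂ) : reInner A B = reInner B A := by
  simp only [reInner, real_inner_comm]

theorem reInner_smul_left (c : ℝ) (A B : Matrix m n ℂ) :
    reInner ((c : ℂ) • A) B = c * reInner A B := by
  simp only [reInner, Finset.mul_sum, Matrix.smul_apply, smul_eq_mul, Complex.inner]
  refine Finset.sum_congr rfl fun i _ => Finset.sum_congr rfl fun j _ => ?_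
  simp
  ring

theorem reInner_neg_right (A B : Matrix m n ℂ) : reInner A (-B) = -reInner A B := by
  simp only [reInner, Matrix.neg_apply, inner_neg_right, Finset.sum_neg_distrib]

theorem sqNorm_smul (c : ℝ) (A : Matrix m n ℂ) : sqNorm ((c : ℂ) • A) = c ^ 2 * sqNorm A := by
  simp only [sqNorm, Finset.mul_sum, Matrix.smul_apply, smul_eq_mul, norm_mul, mul_pow,
    Complex.norm_real, Real.norm_eq_abs, sq_abs]

theorem sqNorm_add (A B : Matrix m n ℂ) :
    sqNorm (A + B) = sqNorm A + 2 * reInner A B + sqNorm B := by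
  simp only [sqNorm, reInner, Finset.mul_sum, ← Finset.sum_add_distrib, Matrix.add_apply,
    norm_add_sq_real]

theorem reInner_mul_left (Φ : Matrix k m ℂ) (A : Matrix m n ℂ) (B : Matrix k n ℂ) :
    reInner (Φ * A) B = reInner A (Φ.conjTranspose * B) := by
  rw [reInner_eq_trace, reInner_eq_trace, Matrix.conjTranspose_mul, Matrix.mul_assoc]

theorem sqNorm_mul_of_isometry [DecidableEq m] {Φ : Matrix k m ℂ} (hΦ : Φ.conjTranspose * Φ = 1)
    (A : Matrix m n ℂ) : sqNorm (Φ * A) = sqNorm A := by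
  rw [← reInner_self, reInner_mul_left, ← Matrix.mul_assoc, hΦ, Matrix.one_mul, reInner_self]

/-- Pythagoras: `ΦΦᴴ` is an orthogonal projection, and the defect is the squared norm of `x - ΦΦᴴx`.
This makes later bounds uniform in `Φ`. -/
theorem sqNorm_conjTranspose_mul_le [DecidableEq m] {Φ : Matrix k m ℂ}
    (hΦ : Φ.conjTranspose * Φ = 1) (x : Matrix k n ℂ) : sqNorm (Φ.conjTranspose * x) ≤ sqNorm x := by
  have h : sqNorm (x + -(Φ * (Φ.conjTranspose * x))) = sqNorm x - sqNorm (Φ.conjTranspose * x) := by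
    rw [sqNorm_add, reInner_neg_right, reInner_comm, reInner_mul_left, reInner_self]
    have : -(Φ * (Φ.conjTranspose * x)) = ((-1 : ℝ) : ℂ) • (Φ * (Φ.conjTranspose * x)) := by simp
    rw [this, sqNorm_smul, sqNorm_mul_of_isometry hΦ]
    ring
  linarith [sqNorm_nonneg (x + -(Φ * (Φ.conjTranspose * x)))]

end MatrixNorm

/-! ### Gaussian matrices: shifts and exponential integrals. -/

section GaussianMatrix

variable {m n : Type*} [Fintype m] [Fintype n]

instance isProbabilityMeasure_gaussianMatrix : IsProbabilityMeasure (gaussianMatrix m n) := by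
  unfold gaussianMatrix
  exact Measure.pi.instIsProbabilityMeasure _

theorem measurePreserving_entry (i : m) (j : n) :
    MeasurePreserving (fun x : Matrix m n ℂ => x i j) (gaussianMatrix m n) stdComplexGaussian :=
  (measurePreserving_eval (fun _ : n => stdComplexGaussian) j).comp
    (measurePreserving_eval (fun _ : m => Measure.pi fun _ : n => stdComplexGaussian) i)

theorem lintegral_gaussianMatrix_prod {f : m → n → ℂ → ENNReal} (hf : ∀ i j, Measurable (f i j)) :
    ∫⁻ x, ∏ i, ∏ j, f i j (x i j) ∂gaussianMatrix m n =
      ∏ i, ∏ j, ∫⁻ z, f i j z ∂stdComplexGaussian := by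
  have hm : ∀ i, Measurable fun y : n → ℂ => ∏ j, f i j (y j) := fun i =>
    Finset.measurable_prod _ fun j _ => (hf i j).comp (measurable_pi_apply j)
  refine (lintegral_pi_prod (μ := fun _ : m => Measure.pi fun _ : n => stdComplexGaussian)
    hm).trans ?_
  exact Finset.prod_congr rfl fun i _ => lintegral_pi_prod (hf i)

theorem gaussianMatrix_withDensity_prod {f : m → n → ℂ → ENNReal} (hf : ∀ i j, Measurable (f i j))
    [∀ i j, IsProbabilityMeasure (stdComplexGaussian.withDensity (f i j))] :
    (gaussianMatrix m n).withDensity (fun x => ∏ i, ∏ j, f i j (x i j)) =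
      (Measure.pi fun i : m => Measure.pi fun j : n => stdComplexGaussian.withDensity (f i j) :
        Measure (m → n → ℂ)) := by
  have hm : ∀ i, Measurable fun y : n → ℂ => ∏ j, f i j (y j) := fun i =>
    Finset.measurable_prod _ fun j _ => (hf i j).comp (measurable_pi_apply j)
  have h1 : ∀ i, (Measure.pi fun j : n => stdComplexGaussian.withDensity (f i j)) =
      (Measure.pi fun _ : n => stdComplexGaussian).withDensity fun y => ∏ j, f i j (y j) :=
    fun i => pi_withDensity (hf i)
  have : ∀ i : m, SigmaFinite ((Measure.pi fun _ : n => stdComplexGaussian).withDensity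
      fun y => ∏ j, f i j (y j)) := fun i => by rw [← h1 i]; infer_instance
  simp_rw [h1]
  exact (pi_withDensity hm).symm

theorem gaussianMatrix_map_add_right (V : Matrix m n ℂ) :
    (gaussianMatrix m n).map (fun w => w + V) = (gaussianMatrix m n).withDensity
      fun w => ENNReal.ofReal (Real.exp (2 * reInner V w - sqNorm V)) := by
  have hf : ∀ i j, Measurable fun w : ℂ =>
      ENNReal.ofReal (Real.exp (2 * inner ℝ (V i j) w - ‖V i j‖ ^ 2)) := fun i j => by fun_prop
  have : ∀ i j, IsProbabilityMeasure (stdComplexGaussian.withDensity fun w : ℂ =>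
      ENNReal.ofReal (Real.exp (2 * inner ℝ (V i j) w - ‖V i j‖ ^ 2))) := fun i j => by
    rw [← stdComplexGaussian_map_add_right]
    exact Measure.isProbabilityMeasure_map (by fun_prop)
  have hprod : (fun w : Matrix m n ℂ => ENNReal.ofReal (Real.exp (2 * reInner V w - sqNorm V))) =
      fun w => ∏ i, ∏ j, ENNReal.ofReal (Real.exp (2 * inner ℝ (V i j) (w i j) - ‖V i j‖ ^ 2)) := by
    funext w
    simp_rw [← ENNReal.ofReal_prod_of_nonneg (fun _ _ => (Real.exp_pos _).le), ← Real.exp_sum]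
    rw [← ENNReal.ofReal_prod_of_nonneg (fun _ _ => (Real.exp_pos _).le), ← Real.exp_sum]
    simp only [reInner, sqNorm, Finset.mul_sum, ← Finset.sum_sub_distrib]
  rw [hprod, gaussianMatrix_withDensity_prod hf]
  simp_rw [← stdComplexGaussian_map_add_right]
  have h1 : ∀ i, (Measure.pi fun j : n => stdComplexGaussian.map fun w => w + V i j) =
      (Measure.pi fun _ : n => stdComplexGaussian).map fun y j => y j + V i j := fun i =>
    (Measure.pi_map_pi (f := fun j (w : ℂ) => w + V i j) (fun j => by fun_prop)).symm
  simp_rw [h1]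
  have hm : ∀ i : m, AEMeasurable (fun (y : n → ℂ) j => y j + V i j)
    (Measure.pi fun _ : n => stdComplexGaussian) := fun i => Measurable.aemeasurable (by fun_prop)
  have : ∀ i : m, IsProbabilityMeasure ((Measure.pi fun _ : n => stdComplexGaussian).map
    fun y j => y j + V i j) := fun i => Measure.isProbabilityMeasure_map (hm i)
  exact Measure.pi_map_pi (μ := fun _ : m => Measure.pi fun _ : n => stdComplexGaussian)
    (f := fun i (y : n → ℂ) j => y j + V i j) hm

theorem lintegral_exp_gaussianMatrix {b : ℝ} (hb : 0 < b) (c : ℝ) (y : Matrix m n ℂ) :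
    ∫⁻ h, ENNReal.ofReal (Real.exp (2 * c * reInner y h - (b - 1) * sqNorm h)) ∂gaussianMatrix m n =
      ENNReal.ofReal (Real.exp (c ^ 2 * sqNorm y / b) /
        b ^ (Fintype.card m * Fintype.card n)) := by
  have hprod : ∀ h : Matrix m n ℂ,
      ENNReal.ofReal (Real.exp (2 * c * reInner y h - (b - 1) * sqNorm h)) =
      ∏ i, ∏ j, (fun z : ℂ => ENNReal.ofReal
        (Real.exp (2 * c * inner ℝ (y i j) z - (b - 1) * ‖z‖ ^ 2))) (h i j) := by
    intro h
    simp_rw [← ENNReal.ofReal_prod_of_nonneg (fun _ _ => (Real.exp_pos _).le), ← Real.exp_sum]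
    rw [← ENNReal.ofReal_prod_of_nonneg (fun _ _ => (Real.exp_pos _).le), ← Real.exp_sum]
    simp only [reInner, sqNorm, Finset.mul_sum, ← Finset.sum_sub_distrib]
  rw [lintegral_congr hprod, lintegral_gaussianMatrix_prod
    (f := fun i j z => ENNReal.ofReal (Real.exp (2 * c * inner ℝ (y i j) z - (b - 1) * ‖z‖ ^ 2)))
    (fun i j => by fun_prop)]
  simp_rw [lintegral_exp_stdComplexGaussian hb]
  have hpos : ∀ i j, 0 ≤ b⁻¹ * Real.exp (c ^ 2 * ‖y i j‖ ^ 2 / b) := fun i j => by positivity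
  simp_rw [← ENNReal.ofReal_prod_of_nonneg (fun _ _ => hpos _ _)]
  rw [← ENNReal.ofReal_prod_of_nonneg (fun _ _ => Finset.prod_nonneg fun _ _ => hpos _ _)]
  simp only [Finset.prod_mul_distrib, ← Real.exp_sum, Finset.prod_const, Finset.card_univ]
  congr 1
  rw [← pow_mul, mul_comm (Fintype.card n), inv_pow, inv_mul_eq_div]
  simp only [sqNorm, Finset.mul_sum, Finset.sum_div]

theorem integrable_exp_sqNorm_gaussianMatrix {t : ℝ} (ht : t < 1) :
    Integrable (fun x => Real.exp (t * sqNorm x)) (gaussianMatrix m n) := by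
  refine (lintegral_ofReal_ne_top_iff_integrable
    (Real.measurable_exp.comp (measurable_sqNorm.const_mul t)).aestronglyMeasurable
    (ae_of_all _ fun _ => (Real.exp_pos _).le)).1 ?_
  have := lintegral_exp_gaussianMatrix (sub_pos.2 ht) 0 (0 : Matrix m n ℂ)
  simp only [mul_zero, zero_mul, zero_sub, sub_sub_cancel_left, neg_mul, neg_neg] at this
  exact this.trans_ne ENNReal.ofReal_ne_top

theorem mgf_sqNorm_gaussianMatrix {t : ℝ} (ht : t < 1) :
    mgf sqNorm (gaussianMatrix m n) t = ((1 - t) ^ (Fintype.card m * Fintype.card n))⁻¹ := by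
  rw [mgf, integral_eq_lintegral_of_nonneg_ae (ae_of_all _ fun _ => (Real.exp_pos _).le)
    (Real.measurable_exp.comp (measurable_sqNorm.const_mul t)).aestronglyMeasurable]
  have := lintegral_exp_gaussianMatrix (sub_pos.2 ht) 0 (0 : Matrix m n ℂ)
  simp only [mul_zero, zero_mul, zero_sub, sub_sub_cancel_left, neg_mul, neg_neg] at this
  have h1 : (0:ℝ) < 1 - t := sub_pos.2 ht
  rw [this, ENNReal.toReal_ofReal (by positivity)]
  simp

end GaussianMatrix

/-! ### Moments of the Frobenius norm of a Gaussian matrix. -/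

section Moments

variable {m n : Type*} [Fintype m] [Fintype n]

theorem mem_interior_integrableExpSet_sqNorm {t : ℝ} (ht : t < 1) :
    t ∈ interior (integrableExpSet sqNorm (gaussianMatrix m n)) :=
  mem_interior.2 ⟨Set.Iio 1, fun _ hu => integrable_exp_sqNorm_gaussianMatrix hu, isOpen_Iio, ht⟩

/-- The squared norm is Gamma distributed, with transform `(1-t)^{-mn}`; each derivative brings down
the next factor of a rising factorial. The claim is kept on all of `t < 1` so that the induction can
differentiate it. -/
theorem iteratedDeriv_mgf_sqNorm (k : ℕ) : ∀ t : ℝ, t < 1 →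
    iteratedDeriv k (mgf sqNorm (gaussianMatrix m n)) t =
      (Fintype.card m * Fintype.card n).ascFactorial k *
        ((1 - t) ^ (Fintype.card m * Fintype.card n + k))⁻¹ := by
  induction k with
  | zero =>
    intro t ht
    simpa using mgf_sqNorm_gaussianMatrix ht
  | succ k ih =>
    intro t ht
    rw [iteratedDeriv_succ]
    have hev : iteratedDeriv k (mgf sqNorm (gaussianMatrix m n)) =ᶠ[𝓝 t] fun u =>
        (Fintype.card m * Fintype.card n).ascFactorial k *
          ((1 - u) ^ (Fintype.card m * Fintype.card n + k))⁻¹ := by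
      filter_upwards [isOpen_Iio.mem_nhds ht] with u hu using ih u hu
    rw [hev.deriv_eq]
    have h1 : 1 - t ≠ 0 := (sub_pos.2 ht).ne'
    have hd := ((((hasDerivAt_id t).const_sub 1).pow
      (Fintype.card m * Fintype.card n + k)).inv (pow_ne_zero _ h1)).const_mul
      ((Fintype.card m * Fintype.card n).ascFactorial k : ℝ)
    refine hd.deriv.trans ?_
    rw [Nat.ascFactorial_succ]
    -- The derivative of a power carries a truncated exponent `- 1`, so exponent zero is treated
    -- apart.
    rcases Nat.eq_zero_or_pos (Fintype.card m * Fintype.card n + k) with h0 | hpos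
    · simp [h0]
    · obtain ⟨j, hj⟩ := Nat.exists_eq_succ_of_ne_zero hpos.ne'
      rw [← add_assoc, hj]
      simp only [Nat.succ_eq_add_one, Pi.pow_apply, id, Nat.add_sub_cancel]
      push_cast
      field_simp
      ring

theorem integral_sqNorm_pow (k : ℕ) :
    ∫ x, sqNorm x ^ k ∂gaussianMatrix m n = (Fintype.card m * Fintype.card n).ascFactorial k := by
  have := iteratedDeriv_mgf_zero (mem_interior_integrableExpSet_sqNorm (m := m) (n := n) one_pos) k
  rw [iteratedDeriv_mgf_sqNorm k 0 one_pos] at this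
  simpa using this.symm

theorem integrable_sqNorm_pow (k : ℕ) :
    Integrable (fun x => sqNorm x ^ k) (gaussianMatrix m n) :=
  integrable_pow_of_mem_interior_integrableExpSet
    (mem_interior_integrableExpSet_sqNorm one_pos) k

/-- The law is invariant under `z ↦ -z` and the integrand is odd. -/
theorem integral_inner_stdComplexGaussian (v : ℂ) :
    ∫ z, inner ℝ v z ∂stdComplexGaussian = 0 := by
  have hneg : stdComplexGaussian.map (fun z => -z) = stdComplexGaussian := by
    rw [stdComplexGaussian_eq_withDensity]
    refine Measure.ext fun s hs => ?_
    rw [Measure.map_apply measurable_neg hs, withDensity_apply _ (measurable_neg hs),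
      withDensity_apply _ hs]
    have key := (Measure.measurePreserving_neg (volume : Measure ℂ)).setLIntegral_comp_preimage_emb
      (MeasurableEquiv.neg ℂ).measurableEmbedding
      (fun w => ENNReal.ofReal (Real.pi⁻¹ * Real.exp (-‖w‖ ^ 2))) s
    simpa only [norm_neg] using key
  have h : ∫ z, inner ℝ v z ∂stdComplexGaussian = ∫ z, inner ℝ v (-z) ∂stdComplexGaussian := by
    conv_lhs => rw [← hneg]
    rw [integral_map (by fun_prop) (by fun_prop)]
  simp only [inner_neg_right, integral_neg] at h
  linarith

theorem integrable_inner_stdComplexGaussian (v : ℂ) :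
    Integrable (fun z => inner ℝ v z) stdComplexGaussian := by
  have h := integrable_sqNorm_pow (m := Unit) (n := Unit) 1
  have h2 : Integrable (fun z : ℂ => ‖z‖ ^ 2) stdComplexGaussian := by
    refine ((measurePreserving_entry (m := Unit) (n := Unit) () ()).integrable_comp
      (by fun_prop)).1 ?_
    simpa [sqNorm, Function.comp_def] using h
  refine ((h2.add (integrable_const 1)).const_mul ‖v‖).mono' (by fun_prop) (ae_of_all _ fun z => ?_)
  refine (norm_inner_le_norm v z).trans (mul_le_mul_of_nonneg_left ?_ (norm_nonneg _))
  simp only [Pi.add_apply]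
  nlinarith [sq_nonneg (‖z‖ - 1)]

theorem integrable_reInner (V : Matrix m n ℂ) :
    Integrable (fun x => reInner V x) (gaussianMatrix m n) :=
  integrable_finsetSum _ fun i _ => integrable_finsetSum _ fun j _ =>
    (measurePreserving_entry i j).integrable_comp_of_integrable
      (integrable_inner_stdComplexGaussian (V i j))

theorem integral_reInner (V : Matrix m n ℂ) : ∫ x, reInner V x ∂gaussianMatrix m n = 0 := by
  have hi : ∀ i j, Integrable (fun x : Matrix m n ℂ => inner ℝ (V i j) (x i j))
      (gaussianMatrix m n) := fun i j =>
    (measurePreserving_entry i j).integrable_comp_of_integrable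
      (integrable_inner_stdComplexGaussian (V i j))
  simp only [reInner]
  rw [integral_finsetSum _ fun i _ => integrable_finsetSum _ fun j _ => hi i j]
  refine Finset.sum_eq_zero fun i _ => ?_
  rw [integral_finsetSum _ fun j _ => hi i j]
  refine Finset.sum_eq_zero fun j _ => ?_
  rw [← integral_inner_stdComplexGaussian (V i j), ← (measurePreserving_entry i j).map_eq,
    integral_map (measurePreserving_entry i j).aemeasurable (by fun_prop)]

theorem integrable_sqNorm_add (V : Matrix m n ℂ) :
    Integrable (fun x => sqNorm (V + x)) (gaussianMatrix m n) := by
  simp_rw [sqNorm_add]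
  exact ((integrable_const _).add ((integrable_reInner V).const_mul 2)).add
    (by simpa using integrable_sqNorm_pow (m := m) (n := n) 1)

theorem integral_sqNorm_add (V : Matrix m n ℂ) :
    ∫ x, sqNorm (V + x) ∂gaussianMatrix m n =
      sqNorm V + Fintype.card m * Fintype.card n := by
  have h1 := integral_sqNorm_pow (m := m) (n := n) 1
  have h2 := integrable_sqNorm_pow (m := m) (n := n) 1
  simp only [pow_one] at h1 h2
  simp_rw [sqNorm_add]
  rw [integral_add (f := fun x => sqNorm V + 2 * reInner V x)
      ((integrable_const _).add ((integrable_reInner V).const_mul 2)) h2,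
    integral_add (integrable_const _) ((integrable_reInner V).const_mul 2), integral_const_mul,
    integral_reInner, h1]
  simp [Nat.ascFactorial]

end Moments

/-! ### Conditional density of the received signal. -/

section Channel

variable {τ μ ν : Type*} [Fintype τ] [Fintype μ]

theorem measurable_received (ρ : ℝ) :
    Measurable fun q : Matrix τ μ ℂ × Matrix μ ν ℂ × Matrix τ ν ℂ =>
      received ρ q.1 q.2.1 q.2.2 :=
  measurable_pi_iff.2 fun i => measurable_pi_iff.2 fun j => by
    simp only [received, Matrix.add_apply, Matrix.smul_apply, Matrix.mul_apply]
    fun_prop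

variable [Fintype ν]

/-- The density, with respect to the law of the noise, of the received signal given `Φ`, at
signal-to-noise parameter `s = ρ T / M`. -/
noncomputable def likelihood (s : ℝ) (Φ : Matrix τ μ ℂ) (x : Matrix τ ν ℂ) : ℝ :=
  Real.exp (s / (1 + s) * sqNorm (Φ.conjTranspose * x)) /
    (1 + s) ^ (Fintype.card μ * Fintype.card ν)

theorem likelihood_pos {s : ℝ} (hs : 0 ≤ s) (Φ : Matrix τ μ ℂ) (x : Matrix τ ν ℂ) :
    0 < likelihood s Φ x := by
  unfold likelihood
  positivity

theorem measurable_likelihood (s : ℝ) :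
    Measurable fun p : Matrix τ μ ℂ × Matrix τ ν ℂ => likelihood s p.1 p.2 := by
  simp only [likelihood, sqNorm, Matrix.mul_apply, Matrix.conjTranspose_apply]
  fun_prop

theorem measurable_likelihood_left (s : ℝ) (x : Matrix τ ν ℂ) :
    Measurable fun Φ : Matrix τ μ ℂ => likelihood s Φ x := by
  simp only [likelihood, sqNorm, Matrix.mul_apply, Matrix.conjTranspose_apply]
  fun_prop

theorem measurable_likelihood_right (s : ℝ) (Φ : Matrix τ μ ℂ) :
    Measurable fun x : Matrix τ ν ℂ => likelihood s Φ x := by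
  simp only [likelihood, sqNorm, Matrix.mul_apply, Matrix.conjTranspose_apply]
  fun_prop

/-- For fixed `H` the output is shifted noise, with density `exp(2√s⟨Φᴴx, H⟩ - s|H|²)` because `|ΦH|
= |H|`. Tonelli and the Gaussian integral with `b = 1 + s` then remove `H`. -/
theorem lintegral_received [DecidableEq μ] {ρ : ℝ} (hρ : 0 < ρ) {Φ : Matrix τ μ ℂ}
    (hΦ : Φ.conjTranspose * Φ = 1) {g : Matrix τ ν ℂ → ENNReal} (hg : Measurable g) :
    ∫⁻ H, ∫⁻ W, g (received ρ Φ H W) ∂gaussianMatrix τ ν ∂gaussianMatrix μ ν =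
      ∫⁻ x, g x * ENNReal.ofReal
        (likelihood (ρ * Fintype.card τ / Fintype.card μ) Φ x) ∂gaussianMatrix τ ν := by
  set s : ℝ := ρ * Fintype.card τ / Fintype.card μ with hs
  have hs0 : 0 ≤ s := by positivity
  have hsq : Real.sqrt s ^ 2 = s := Real.sq_sqrt hs0
  have hadd : Measurable fun p : Matrix τ ν ℂ × Matrix τ ν ℂ => p.1 + p.2 :=
    measurable_pi_iff.2 fun i => measurable_pi_iff.2 fun j => by
      simp only [Matrix.add_apply]
      fun_prop
  have h1 : ∀ H : Matrix μ ν ℂ, ∫⁻ W, g (received ρ Φ H W) ∂gaussianMatrix τ ν =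
      ∫⁻ x, g x * ENNReal.ofReal (Real.exp (2 * Real.sqrt s * reInner (Φ.conjTranspose * x) H -
        s * sqNorm H)) ∂gaussianMatrix τ ν := by
    intro H
    have hmap := gaussianMatrix_map_add_right (((Real.sqrt s : ℝ) : ℂ) • (Φ * H))
    have hm : Measurable fun W : Matrix τ ν ℂ => W + ((Real.sqrt s : ℝ) : ℂ) • (Φ * H) :=
      hadd.comp (measurable_id.prodMk measurable_const)
    have hd : Measurable fun x : Matrix τ ν ℂ => ENNReal.ofReal
        (Real.exp (2 * reInner (((Real.sqrt s : ℝ) : ℂ) • (Φ * H)) x -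
          sqNorm (((Real.sqrt s : ℝ) : ℂ) • (Φ * H)))) := by
      unfold reInner
      fun_prop
    have : ∫⁻ W, g (received ρ Φ H W) ∂gaussianMatrix τ ν =
        ∫⁻ x, g x ∂(gaussianMatrix τ ν).map
          fun W => W + ((Real.sqrt s : ℝ) : ℂ) • (Φ * H) := by
      rw [lintegral_map hg hm]
      exact lintegral_congr fun W => by rw [received, add_comm]
    rw [this, hmap, lintegral_withDensity_eq_lintegral_mul _ hd hg]
    refine lintegral_congr fun x => ?_
    rw [Pi.mul_apply, mul_comm, reInner_smul_left, sqNorm_smul, sqNorm_mul_of_isometry hΦ, hsq,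
      reInner_mul_left, reInner_comm H, ← mul_assoc]
  simp_rw [h1]
  rw [lintegral_lintegral_swap]
  · refine lintegral_congr fun x => ?_
    have hm : Measurable fun H : Matrix μ ν ℂ => ENNReal.ofReal
        (Real.exp (2 * Real.sqrt s * reInner (Φ.conjTranspose * x) H - s * sqNorm H)) := by
      unfold reInner sqNorm
      fun_prop
    rw [lintegral_const_mul _ hm]
    congr 1
    have := lintegral_exp_gaussianMatrix (by positivity : 0 < 1 + s) (Real.sqrt s)
      (Φ.conjTranspose * x)
    rw [add_sub_cancel_left, hsq] at this
    rw [this, likelihood, div_mul_eq_mul_div s (1 + s)]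
  · refine Measurable.aemeasurable ?_
    refine (hg.comp measurable_snd).mul ?_
    simp only [reInner, sqNorm, Matrix.mul_apply, Matrix.conjTranspose_apply]
    fun_prop

theorem lintegral_likelihood [DecidableEq μ] [Nonempty μ] [Nonempty τ] {s : ℝ} (hs : 0 < s)
    {Φ : Matrix τ μ ℂ} (hΦ : Φ.conjTranspose * Φ = 1) :
    ∫⁻ x, ENNReal.ofReal (likelihood s Φ x) ∂gaussianMatrix τ ν = 1 := by
  have hc1 : (Fintype.card τ : ℝ) ≠ 0 := Nat.cast_ne_zero.2 Fintype.card_ne_zero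
  have hc2 : (Fintype.card μ : ℝ) ≠ 0 := Nat.cast_ne_zero.2 Fintype.card_ne_zero
  have := lintegral_received (ν := ν) (ρ := s * Fintype.card μ / Fintype.card τ)
    (by positivity) hΦ (g := fun _ => 1) measurable_const
  rw [show s * Fintype.card μ / Fintype.card τ * Fintype.card τ / Fintype.card μ = s by
    field_simp] at this
  simpa using this.symm

end Channel

/-! ### Kullback–Leibler divergence from an explicit density. -/

section KL

variable {α : Type*} [MeasurableSpace α]

theorem klDiv_withDensity_ne_top_and_toReal {J Q : Measure α} [IsProbabilityMeasure J]
    [IsProbabilityMeasure Q] {f : α → ℝ} (hf : Measurable f) (hpos : ∀ x, 0 < f x)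
    (hJ : J = Q.withDensity fun x => ENNReal.ofReal (f x))
    (hint : Integrable (fun x => Real.log (f x)) J) :
    InformationTheory.klDiv J Q ≠ ⊤ ∧
      (InformationTheory.klDiv J Q).toReal = ∫ x, Real.log (f x) ∂J := by
  have hac : J ≪ Q := hJ ▸ withDensity_absolutelyContinuous _ _
  have hrn : J.rnDeriv Q =ᵐ[Q] fun x => ENNReal.ofReal (f x) := by
    rw [hJ]
    exact Measure.rnDeriv_withDensity Q (by fun_prop)
  have hllr : llr J Q =ᵐ[J] fun x => Real.log (f x) := by
    filter_upwards [hac.ae_le hrn] with x hx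
    rw [llr, hx, ENNReal.toReal_ofReal (hpos x).le]
  have hint' : Integrable (llr J Q) J := hint.congr hllr.symm
  refine ⟨InformationTheory.klDiv_ne_top hac hint', ?_⟩
  rw [InformationTheory.toReal_klDiv_of_measure_eq hac (by simp), integral_congr_ae hllr]

end KL

/-! ### Output density and the joint law as a density over the product of its marginals. -/

section Channel

variable {τ μ ν : Type*} [Fintype τ] [Fintype μ] [Fintype ν]

/-- The density of the received signal with respect to the law of the noise. -/
noncomputable def marginalDensity (s : ℝ) (P : Measure (Matrix τ μ ℂ)) (x : Matrix τ ν ℂ) : ℝ :=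
  ∫ Φ, likelihood s Φ x ∂P

theorem measurable_marginalDensity (P : Measure (Matrix τ μ ℂ)) [IsProbabilityMeasure P] (s : ℝ) :
    Measurable fun x : Matrix τ ν ℂ => marginalDensity s P x :=
  ((measurable_likelihood s).stronglyMeasurable.integral_prod_left' (μ := P)).measurable

theorem lintegral_jointLaw (P : Measure (Matrix τ μ ℂ)) [IsProbabilityMeasure P] (ρ : ℝ) {g : Matrix τ μ ℂ × Matrix τ ν ℂ → ENNReal}
    (hg : Measurable g) :
    ∫⁻ p, g p ∂jointLaw ρ P =
      ∫⁻ Φ, ∫⁻ H, ∫⁻ W, g (Φ, received ρ Φ H W) ∂gaussianMatrix τ ν ∂gaussianMatrix μ ν ∂P := by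
  have hm : Measurable fun q : Matrix τ μ ℂ × Matrix μ ν ℂ × Matrix τ ν ℂ =>
      (q.1, received ρ q.1 q.2.1 q.2.2) := measurable_fst.prodMk (measurable_received ρ)
  rw [jointLaw, lintegral_map hg hm]
  refine (lintegral_prod _ (hg.comp hm).aemeasurable).trans ?_
  refine lintegral_congr fun Φ => ?_
  exact lintegral_prod _ ((hg.comp hm).comp (measurable_const.prodMk measurable_id)).aemeasurable

theorem isProbabilityMeasure_jointLaw {P : Measure (Matrix τ μ ℂ)} [IsProbabilityMeasure P] (ρ : ℝ) :
    IsProbabilityMeasure (jointLaw (ν := ν) ρ P) :=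
  Measure.isProbabilityMeasure_map
    (measurable_fst.prodMk (measurable_received ρ)).aemeasurable

theorem fst_jointLaw (P : Measure (Matrix τ μ ℂ)) (ρ : ℝ) : (jointLaw (ν := ν) ρ P).fst = P := by
  rw [Measure.fst, jointLaw, Measure.map_map measurable_fst
    (measurable_fst.prodMk (measurable_received ρ))]
  exact (measurePreserving_fst (μ := P)
    (ν := (gaussianMatrix μ ν).prod (gaussianMatrix τ ν))).map_eq

variable [DecidableEq μ]

theorem one_sub_div_one_add {s : ℝ} (hs : 0 < s) : 1 - s / (1 + s) = (1 + s)⁻¹ := by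
  field_simp
  ring

variable {P : Measure (Matrix τ μ ℂ)} [IsProbabilityMeasure P]

theorem jointLaw_eq_withDensity (hP : ∀ᵐ Φ ∂P, Φ.conjTranspose * Φ = 1)
    {ρ : ℝ} (hρ : 0 < ρ) :
    jointLaw ρ P = (P.prod (gaussianMatrix τ ν)).withDensity fun p =>
      ENNReal.ofReal (likelihood (ρ * Fintype.card τ / Fintype.card μ) p.1 p.2) := by
  refine Measure.ext_of_lintegral _ fun g hg => ?_
  have hL := (measurable_likelihood (τ := τ) (μ := μ) (ν := ν)
    (ρ * Fintype.card τ / Fintype.card μ)).ennreal_ofReal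
  rw [lintegral_jointLaw P ρ hg, lintegral_withDensity_eq_lintegral_mul _ hL hg,
    lintegral_prod _ (hL.mul hg).aemeasurable]
  refine lintegral_congr_ae ?_
  filter_upwards [hP] with Φ hΦ
  have hgΦ : Measurable fun x => g (Φ, x) := hg.comp (measurable_const.prodMk measurable_id)
  rw [lintegral_received hρ hΦ hgΦ]
  exact lintegral_congr fun x => mul_comm _ _

theorem likelihood_le_and_integrable (hP : ∀ᵐ Φ ∂P, Φ.conjTranspose * Φ = 1)
    {s : ℝ} (hs : 0 < s) (x : Matrix τ ν ℂ) :
    (∀ᵐ Φ ∂P, likelihood s Φ x ≤ Real.exp (s / (1 + s) * sqNorm x) /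
      (1 + s) ^ (Fintype.card μ * Fintype.card ν)) ∧
    Integrable (fun Φ => likelihood s Φ x) P := by
  have h : ∀ᵐ Φ ∂P, likelihood s Φ x ≤ Real.exp (s / (1 + s) * sqNorm x) /
      (1 + s) ^ (Fintype.card μ * Fintype.card ν) := by
    filter_upwards [hP] with Φ hΦ
    unfold likelihood
    gcongr
    exact sqNorm_conjTranspose_mul_le hΦ x
  refine ⟨h, Integrable.mono' (integrable_const (Real.exp (s / (1 + s) * sqNorm x) /
    (1 + s) ^ (Fintype.card μ * Fintype.card ν))) (measurable_likelihood_left s x).aestronglyMeasurable ?_⟩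
  filter_upwards [h] with Φ hΦ
  rwa [Real.norm_of_nonneg (likelihood_pos hs.le Φ x).le]

theorem marginalDensity_le (hP : ∀ᵐ Φ ∂P, Φ.conjTranspose * Φ = 1)
    {s : ℝ} (hs : 0 < s) (x : Matrix τ ν ℂ) :
    marginalDensity s P x ≤ Real.exp (s / (1 + s) * sqNorm x) /
      (1 + s) ^ (Fintype.card μ * Fintype.card ν) := by
  obtain ⟨h1, h2⟩ := likelihood_le_and_integrable hP hs x
  exact (integral_mono_ae h2 (integrable_const _) h1).trans (by simp)

theorem le_marginalDensity (hP : ∀ᵐ Φ ∂P, Φ.conjTranspose * Φ = 1)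
    {s : ℝ} (hs : 0 < s) (x : Matrix τ ν ℂ) :
    ((1 + s) ^ (Fintype.card μ * Fintype.card ν))⁻¹ ≤ marginalDensity s P x := by
  obtain ⟨h1, h2⟩ := likelihood_le_and_integrable hP hs x
  refine le_trans (by simp) (integral_mono_ae (integrable_const
    ((1 + s) ^ (Fintype.card μ * Fintype.card ν))⁻¹) h2 (ae_of_all _ fun Φ => ?_))
  simp only [likelihood]
  rw [← one_div]
  gcongr
  exact Real.one_le_exp (mul_nonneg (by positivity) (sqNorm_nonneg _))

theorem marginalDensity_pos (hP : ∀ᵐ Φ ∂P, Φ.conjTranspose * Φ = 1)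
    {s : ℝ} (hs : 0 < s) (x : Matrix τ ν ℂ) :
    0 < marginalDensity s P x :=
  lt_of_lt_of_le (by positivity) (le_marginalDensity hP hs x)

variable [Nonempty μ] [Nonempty τ]

/-- `Φᴴx` is a standard Gaussian matrix, but its law is not needed: the transform can be read off
from the fact that the likelihood has total mass one, at the parameter `s = t/(1-t)`, for which
`s/(1+s) = t`. -/
theorem mgf_sqNorm_conjTranspose_mul {Φ : Matrix τ μ ℂ} (hΦ : Φ.conjTranspose * Φ = 1) {t : ℝ}
    (ht : t ∈ Set.Ioo (0 : ℝ) 1) :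
    Integrable (fun x : Matrix τ ν ℂ => Real.exp (t * sqNorm (Φ.conjTranspose * x)))
      (gaussianMatrix τ ν) ∧
    mgf (fun x : Matrix τ ν ℂ => sqNorm (Φ.conjTranspose * x)) (gaussianMatrix τ ν) t =
      ((1 - t) ^ (Fintype.card μ * Fintype.card ν))⁻¹ := by
  obtain ⟨h0, h1⟩ := ht
  have h1' : 0 < 1 - t := sub_pos.2 h1
  obtain ⟨s, hs0, hts, h1s⟩ : ∃ s : ℝ, 0 < s ∧ s / (1 + s) = t ∧ 1 + s = (1 - t)⁻¹ := by
    have h1s : 1 + t / (1 - t) = (1 - t)⁻¹ := by field_simp; ring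
    refine ⟨t / (1 - t), by positivity, ?_, h1s⟩
    rw [h1s]
    field_simp
  have hm := measurable_likelihood_right (ν := ν) s Φ
  have hl := lintegral_likelihood (ν := ν) hs0 hΦ
  have hnn : 0 ≤ᵐ[gaussianMatrix τ ν] fun x : Matrix τ ν ℂ => likelihood s Φ x :=
    ae_of_all _ fun x => (likelihood_pos hs0.le Φ x).le
  have hint : Integrable (fun x : Matrix τ ν ℂ => likelihood s Φ x) (gaussianMatrix τ ν) :=
    (lintegral_ofReal_ne_top_iff_integrable hm.aestronglyMeasurable hnn).1 (by simp [hl])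
  have hval : ∫ x : Matrix τ ν ℂ, likelihood s Φ x ∂gaussianMatrix τ ν = 1 := by
    rw [integral_eq_lintegral_of_nonneg_ae hnn hm.aestronglyMeasurable, hl, ENNReal.toReal_one]
  have hE : ∀ x : Matrix τ ν ℂ, Real.exp (t * sqNorm (Φ.conjTranspose * x)) =
      ((1 - t) ^ (Fintype.card μ * Fintype.card ν))⁻¹ * likelihood s Φ x := by
    intro x
    have : (1 - t) ^ (Fintype.card μ * Fintype.card ν) ≠ 0 := pow_ne_zero _ h1'.ne'
    rw [likelihood, hts, h1s, inv_pow, div_inv_eq_mul, mul_left_comm, inv_mul_cancel₀ this,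
      mul_one]
  exact ⟨(integrable_congr (ae_of_all _ hE)).2 (hint.const_mul _), by
    rw [mgf, integral_congr_ae (ae_of_all _ hE), integral_const_mul, hval, mul_one]⟩

/-- Differentiating the preceding transform at `s/(1+s)` inserts the factor `|Φᴴx|²`. The value says
that, under the conditional law, the entries of `ΦᴴX` have variance `1 + s`. -/
theorem integral_sqNorm_mul_likelihood {Φ : Matrix τ μ ℂ} (hΦ : Φ.conjTranspose * Φ = 1) {s : ℝ}
    (hs : 0 < s) :
    Integrable (fun x : Matrix τ ν ℂ => sqNorm (Φ.conjTranspose * x) * likelihood s Φ x)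
      (gaussianMatrix τ ν) ∧
    ∫ x : Matrix τ ν ℂ, sqNorm (Φ.conjTranspose * x) * likelihood s Φ x ∂gaussianMatrix τ ν =
      Fintype.card μ * Fintype.card ν * (1 + s) := by
  have ha : s / (1 + s) ∈ Set.Ioo (0 : ℝ) 1 := ⟨by positivity, by rw [div_lt_one] <;> linarith⟩
  have hmem : s / (1 + s) ∈ interior (integrableExpSet
      (fun x : Matrix τ ν ℂ => sqNorm (Φ.conjTranspose * x)) (gaussianMatrix τ ν)) :=
    mem_interior.2 ⟨Set.Ioo 0 1, fun u hu => (mgf_sqNorm_conjTranspose_mul hΦ hu).1, isOpen_Ioo, ha⟩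
  have hd := deriv_mgf hmem
  have hi := integrable_pow_mul_exp_of_mem_interior_integrableExpSet hmem 1
  simp only [pow_one] at hi
  have hev : mgf (fun x : Matrix τ ν ℂ => sqNorm (Φ.conjTranspose * x)) (gaussianMatrix τ ν)
      =ᶠ[𝓝 (s / (1 + s))] fun u => ((1 - u) ^ (Fintype.card μ * Fintype.card ν))⁻¹ := by
    filter_upwards [isOpen_Ioo.mem_nhds ha] with u hu using (mgf_sqNorm_conjTranspose_mul hΦ hu).2
  have h1 : 1 - s / (1 + s) ≠ 0 := (sub_pos.2 ha.2).ne'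
  have hd' := ((((hasDerivAt_id (s / (1 + s))).const_sub 1).pow
    (Fintype.card μ * Fintype.card ν)).inv (pow_ne_zero _ h1)).deriv
  have hE : ∀ x : Matrix τ ν ℂ, sqNorm (Φ.conjTranspose * x) * likelihood s Φ x =
      ((1 + s) ^ (Fintype.card μ * Fintype.card ν))⁻¹ * (sqNorm (Φ.conjTranspose * x) *
        Real.exp (s / (1 + s) * sqNorm (Φ.conjTranspose * x))) := by
    intro x
    rw [likelihood]
    ring
  simp_rw [hE]
  refine ⟨hi.const_mul _, ?_⟩
  rw [integral_const_mul, ← hd, hev.deriv_eq]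
  refine (congrArg _ hd').trans ?_
  simp only [Pi.pow_apply, id, one_sub_div_one_add hs]
  have h1s : 0 < 1 + s := by positivity
  rcases Nat.eq_zero_or_pos (Fintype.card μ * Fintype.card ν) with h0 | hpos
  · have h0' : (Fintype.card μ : ℝ) * Fintype.card ν = 0 := by exact_mod_cast h0
    simp [h0, h0']
  · obtain ⟨j, hj⟩ := Nat.exists_eq_succ_of_ne_zero hpos.ne'
    have hj' : (Fintype.card μ : ℝ) * Fintype.card ν = j + 1 := by exact_mod_cast hj
    rw [hj, hj']
    simp only [Nat.succ_eq_add_one, Nat.add_sub_cancel]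
    have h1 : (1 + s) * (1 + s)⁻¹ = 1 := mul_inv_cancel₀ h1s.ne'
    rw [← inv_pow]
    push_cast
    generalize (1 + s)⁻¹ = u at h1 ⊢
    have hu : u ≠ 0 := right_ne_zero_of_mul_eq_one h1
    rw [← mul_div_assoc, div_eq_iff (by positivity)]
    linear_combination (-(j + 1) * u ^ (2 * j + 1)) * h1

theorem snd_jointLaw (hP : ∀ᵐ Φ ∂P, Φ.conjTranspose * Φ = 1)
    {ρ : ℝ} (hρ : 0 < ρ) :
    (jointLaw ρ P).snd = (gaussianMatrix τ ν).withDensity fun x =>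
      ENNReal.ofReal (marginalDensity (ρ * Fintype.card τ / Fintype.card μ) P x) := by
  have hs : 0 < ρ * Fintype.card τ / Fintype.card μ := by
    have := Fintype.card_pos (α := τ)
    have := Fintype.card_pos (α := μ)
    positivity
  have hL := (measurable_likelihood (τ := τ) (μ := μ) (ν := ν)
    (ρ * Fintype.card τ / Fintype.card μ)).ennreal_ofReal
  refine Measure.ext_of_lintegral _ fun g hg => ?_
  have hg2 : Measurable fun p : Matrix τ μ ℂ × Matrix τ ν ℂ => g p.2 := hg.comp measurable_snd
  rw [Measure.snd, lintegral_map hg measurable_snd, jointLaw_eq_withDensity hP hρ,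
    lintegral_withDensity_eq_lintegral_mul _ hL hg2,
    lintegral_withDensity_eq_lintegral_mul _ (measurable_marginalDensity P _).ennreal_ofReal hg,
    lintegral_prod_symm _ (hL.mul hg2).aemeasurable]
  refine lintegral_congr fun x => ?_
  simp only [Pi.mul_apply]
  rw [lintegral_mul_const _ (measurable_likelihood_left _ x).ennreal_ofReal, marginalDensity,
    ofReal_integral_eq_lintegral_ofReal (likelihood_le_and_integrable hP hs x).2
      (ae_of_all _ fun Φ => (likelihood_pos hs.le Φ x).le)]

theorem jointLaw_eq_prod_withDensity (hP : ∀ᵐ Φ ∂P, Φ.conjTranspose * Φ = 1)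
    {ρ : ℝ} (hρ : 0 < ρ) :
    jointLaw (ν := ν) ρ P =
      ((jointLaw (ν := ν) ρ P).fst.prod (jointLaw (ν := ν) ρ P).snd).withDensity fun p =>
      ENNReal.ofReal (likelihood (ρ * Fintype.card τ / Fintype.card μ) p.1 p.2 /
        marginalDensity (ρ * Fintype.card τ / Fintype.card μ) P p.2) := by
  have hs : 0 < ρ * Fintype.card τ / Fintype.card μ := by
    have := Fintype.card_pos (α := τ)
    have := Fintype.card_pos (α := μ)
    positivity
  have hL := measurable_likelihood (τ := τ) (μ := μ) (ν := ν)
    (ρ * Fintype.card τ / Fintype.card μ)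
  have hZ := measurable_marginalDensity (ν := ν) P (ρ * Fintype.card τ / Fintype.card μ)
  have := isProbabilityMeasure_jointLaw (ν := ν) (P := P) ρ
  have : SFinite ((gaussianMatrix τ ν).withDensity fun x =>
      ENNReal.ofReal (marginalDensity (ρ * Fintype.card τ / Fintype.card μ) P x)) := by
    rw [← snd_jointLaw hP hρ]
    infer_instance
  have hZ2 : Measurable fun p : Matrix τ μ ℂ × Matrix τ ν ℂ =>
      marginalDensity (ρ * Fintype.card τ / Fintype.card μ) P p.2 := hZ.comp measurable_snd
  have hLZ : Measurable fun p : Matrix τ μ ℂ × Matrix τ ν ℂ =>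
      likelihood (ρ * Fintype.card τ / Fintype.card μ) p.1 p.2 /
        marginalDensity (ρ * Fintype.card τ / Fintype.card μ) P p.2 := hL.div hZ2
  rw [fst_jointLaw, snd_jointLaw hP hρ, prod_withDensity_right hZ.ennreal_ofReal,
    ← withDensity_mul _ hZ2.ennreal_ofReal hLZ.ennreal_ofReal, jointLaw_eq_withDensity hP hρ]
  congr 1
  funext p
  have hpos := marginalDensity_pos hP hs p.2
  rw [Pi.mul_apply]
  rw [← ENNReal.ofReal_mul hpos.le, mul_div_cancel₀ _ hpos.ne']

end Channel

/-! ### Energy identities and the formula for the mutual information. -/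

section Channel

variable {τ μ ν : Type*} [Fintype τ] [Fintype μ] [Fintype ν]

theorem measurable_sqNorm_conjTranspose_mul :
    Measurable fun p : Matrix τ μ ℂ × Matrix τ ν ℂ => sqNorm (p.1.conjTranspose * p.2) := by
  simp only [sqNorm, Matrix.mul_apply, Matrix.conjTranspose_apply]
  fun_prop

variable [DecidableEq μ] {P : Measure (Matrix τ μ ℂ)} [IsProbabilityMeasure P]

/-- Averaging `0 ≤ |Φᴴx|² ≤ |x|²` through the likelihood traps the density on both sides. With the
finite output energy, this gives integrability of its logarithm. -/
theorem abs_log_marginalDensity_le (hP : ∀ᵐ Φ ∂P, Φ.conjTranspose * Φ = 1) {s : ℝ}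
    (hs : 0 < s) (x : Matrix τ ν ℂ) :
    |Real.log (marginalDensity s P x)| ≤
      s / (1 + s) * sqNorm x + Fintype.card μ * Fintype.card ν * Real.log (1 + s) := by
  have h1 := marginalDensity_le hP hs x
  have h2 := le_marginalDensity hP hs x
  have hl : 0 ≤ Real.log (1 + s) := Real.log_nonneg (by linarith)
  have hq : 0 ≤ s / (1 + s) * sqNorm x := mul_nonneg (by positivity) (sqNorm_nonneg x)
  have hK : (0:ℝ) ≤ Fintype.card μ * Fintype.card ν * Real.log (1 + s) := by positivity
  have h1' := Real.log_le_log (marginalDensity_pos hP hs x) h1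
  have h2' := Real.log_le_log (by positivity) h2
  rw [Real.log_div (Real.exp_pos _).ne' (by positivity), Real.log_exp, Real.log_pow] at h1'
  rw [Real.log_inv, Real.log_pow] at h2'
  push_cast at h1' h2'
  rw [abs_le]
  constructor <;> linarith

variable [Nonempty μ] [Nonempty τ]

/-- Signal and noise energies add, since the cross term has mean zero. The answer does not depend on
the input law beyond orthonormality of the columns. -/
theorem integral_snd_sqNorm_jointLaw (hP : ∀ᵐ Φ ∂P, Φ.conjTranspose * Φ = 1) {ρ : ℝ}
    (hρ : 0 < ρ) :
    Integrable (fun p => sqNorm p.2) (jointLaw (ν := ν) ρ P) ∧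
    ∫ p, sqNorm p.2 ∂jointLaw (ν := ν) ρ P =
      ρ * Fintype.card τ / Fintype.card μ * (Fintype.card μ * Fintype.card ν) +
        Fintype.card τ * Fintype.card ν := by
  set s : ℝ := ρ * Fintype.card τ / Fintype.card μ with hs
  have hs0 : 0 ≤ s := by positivity
  have hm : Measurable fun p : Matrix τ μ ℂ × Matrix τ ν ℂ => sqNorm p.2 :=
    measurable_sqNorm.comp measurable_snd
  have hnn : 0 ≤ᵐ[jointLaw (ν := ν) ρ P] fun p => sqNorm p.2 :=
    ae_of_all _ fun p => sqNorm_nonneg _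
  have hl : ∫⁻ p, ENNReal.ofReal (sqNorm p.2) ∂jointLaw (ν := ν) ρ P =
      ENNReal.ofReal (s * (Fintype.card μ * Fintype.card ν) +
        Fintype.card τ * Fintype.card ν) := by
    rw [lintegral_jointLaw P ρ hm.ennreal_ofReal]
    have hΦ : ∀ᵐ Φ ∂P, ∫⁻ H, ∫⁻ W, ENNReal.ofReal (sqNorm (received ρ Φ H W))
        ∂gaussianMatrix τ ν ∂gaussianMatrix μ ν = ENNReal.ofReal (s * (Fintype.card μ *
          Fintype.card ν) + Fintype.card τ * Fintype.card ν) := by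
      filter_upwards [hP] with Φ hΦ
      have hW : ∀ H : Matrix μ ν ℂ, ∫⁻ W, ENNReal.ofReal (sqNorm (received ρ Φ H W))
          ∂gaussianMatrix τ ν =
          ENNReal.ofReal (s * sqNorm H + Fintype.card τ * Fintype.card ν) := by
        intro H
        have h1 := integral_sqNorm_add (((Real.sqrt s : ℝ) : ℂ) • (Φ * H))
        rw [sqNorm_smul, sqNorm_mul_of_isometry hΦ, Real.sq_sqrt hs0] at h1
        rw [← h1, ofReal_integral_eq_lintegral_ofReal (integrable_sqNorm_add _)
          (ae_of_all _ fun _ => sqNorm_nonneg _)]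
        rfl
      simp_rw [hW]
      have hi : Integrable (fun H : Matrix μ ν ℂ => s * sqNorm H) (gaussianMatrix μ ν) := by
        simpa using (integrable_sqNorm_pow (m := μ) (n := ν) 1).const_mul s
      have hi' : Integrable (fun H : Matrix μ ν ℂ => s * sqNorm H +
          (Fintype.card τ * Fintype.card ν : ℝ)) (gaussianMatrix μ ν) := hi.add (integrable_const _)
      rw [← ofReal_integral_eq_lintegral_ofReal hi'
        (ae_of_all _ fun H => add_nonneg (mul_nonneg hs0 (sqNorm_nonneg H)) (by positivity)),
        integral_add hi (integrable_const _), integral_const_mul]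
      have := integral_sqNorm_pow (m := μ) (n := ν) 1
      simp only [pow_one] at this
      rw [this]
      simp [Nat.ascFactorial]
    rw [lintegral_congr_ae hΦ]
    simp
  refine ⟨(lintegral_ofReal_ne_top_iff_integrable hm.aestronglyMeasurable hnn).1
    (by rw [hl]; exact ENNReal.ofReal_ne_top), ?_⟩
  rw [integral_eq_lintegral_of_nonneg_ae hnn hm.aestronglyMeasurable, hl,
    ENNReal.toReal_ofReal (by positivity)]

theorem integral_sqNorm_conjTranspose_mul_jointLaw
    (hP : ∀ᵐ Φ ∂P, Φ.conjTranspose * Φ = 1) {ρ : ℝ} (hρ : 0 < ρ) :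
    Integrable (fun p => sqNorm (p.1.conjTranspose * p.2)) (jointLaw (ν := ν) ρ P) ∧
    ∫ p, sqNorm (p.1.conjTranspose * p.2) ∂jointLaw (ν := ν) ρ P =
      Fintype.card μ * Fintype.card ν * (1 + ρ * Fintype.card τ / Fintype.card μ) := by
  set s : ℝ := ρ * Fintype.card τ / Fintype.card μ with hs
  have hs0 : 0 < s := by
    have := Fintype.card_pos (α := τ)
    have := Fintype.card_pos (α := μ)
    positivity
  have hm := measurable_sqNorm_conjTranspose_mul (τ := τ) (μ := μ) (ν := ν)
  have hL := (measurable_likelihood (τ := τ) (μ := μ) (ν := ν) s).ennreal_ofReal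
  have hnn : 0 ≤ᵐ[jointLaw (ν := ν) ρ P] fun p => sqNorm (p.1.conjTranspose * p.2) :=
    ae_of_all _ fun p => sqNorm_nonneg _
  have hl : ∫⁻ p, ENNReal.ofReal (sqNorm (p.1.conjTranspose * p.2)) ∂jointLaw (ν := ν) ρ P =
      ENNReal.ofReal (Fintype.card μ * Fintype.card ν * (1 + s)) := by
    rw [jointLaw_eq_withDensity hP hρ, ← hs,
      lintegral_withDensity_eq_lintegral_mul _ hL hm.ennreal_ofReal,
      lintegral_prod _ (hL.mul hm.ennreal_ofReal).aemeasurable]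
    have hΦ : ∀ᵐ Φ ∂P, ∫⁻ x : Matrix τ ν ℂ, ENNReal.ofReal (likelihood s Φ x) *
        ENNReal.ofReal (sqNorm (Φ.conjTranspose * x)) ∂gaussianMatrix τ ν =
        ENNReal.ofReal (Fintype.card μ * Fintype.card ν * (1 + s)) := by
      filter_upwards [hP] with Φ hΦ
      obtain ⟨h1, h2⟩ := integral_sqNorm_mul_likelihood (ν := ν) hΦ hs0
      rw [← h2, ofReal_integral_eq_lintegral_ofReal h1 (ae_of_all _ fun x =>
        mul_nonneg (sqNorm_nonneg _) (likelihood_pos hs0.le Φ x).le)]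
      refine lintegral_congr fun x => ?_
      rw [ENNReal.ofReal_mul (sqNorm_nonneg _), mul_comm]
    refine (lintegral_congr_ae hΦ).trans ?_
    simp
  refine ⟨(lintegral_ofReal_ne_top_iff_integrable hm.aestronglyMeasurable hnn).1
    (by rw [hl]; exact ENNReal.ofReal_ne_top), ?_⟩
  rw [integral_eq_lintegral_of_nonneg_ae hnn hm.aestronglyMeasurable, hl,
    ENNReal.toReal_ofReal (by positivity)]

theorem integrable_and_integral_snd_jointLaw (hP : ∀ᵐ Φ ∂P, Φ.conjTranspose * Φ = 1) {ρ : ℝ}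
    (hρ : 0 < ρ) {g : Matrix τ ν ℂ → ℝ} (hg : Measurable g) :
    (Integrable (fun p => g p.2) (jointLaw (ν := ν) ρ P) ↔
      Integrable (fun x => marginalDensity (ρ * Fintype.card τ / Fintype.card μ) P x * g x)
        (gaussianMatrix τ ν)) ∧
    ∫ p, g p.2 ∂jointLaw (ν := ν) ρ P =
      ∫ x, marginalDensity (ρ * Fintype.card τ / Fintype.card μ) P x * g x
        ∂gaussianMatrix τ ν := by
  have hs0 : 0 < ρ * Fintype.card τ / Fintype.card μ := by
    have := Fintype.card_pos (α := τ)
    have := Fintype.card_pos (α := μ)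
    positivity
  have hZ := measurable_marginalDensity (ν := ν) P (ρ * Fintype.card τ / Fintype.card μ)
  have hsnd := snd_jointLaw (ν := ν) hP hρ
  rw [Measure.snd] at hsnd
  constructor
  · have h1 : Integrable (fun p => g p.2) (jointLaw (ν := ν) ρ P) ↔
        Integrable g ((jointLaw (ν := ν) ρ P).map Prod.snd) :=
      (integrable_map_measure hg.aestronglyMeasurable measurable_snd.aemeasurable).symm
    rw [h1, hsnd, integrable_withDensity_iff_integrable_smul' hZ.ennreal_ofReal
      (ae_of_all _ fun _ => ENNReal.ofReal_lt_top)]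
    simp only [ENNReal.toReal_ofReal (marginalDensity_pos hP hs0 _).le, smul_eq_mul]
  · rw [← integral_map (μ := jointLaw (ν := ν) ρ P) measurable_snd.aemeasurable
      hg.aestronglyMeasurable, hsnd, integral_withDensity_eq_integral_toReal_smul
      hZ.ennreal_ofReal (ae_of_all _ fun _ => ENNReal.ofReal_lt_top)]
    simp only [ENNReal.toReal_ofReal (marginalDensity_pos hP hs0 _).le, smul_eq_mul]

/-- The logarithm of the density splits as `log L - log Z`. The first mean is explicit because
`E|ΦᴴX|² = MN(1+s)`; the second is moved to the noise law, where `X` has density `Z`. -/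
theorem mutualInfo_jointLaw (hP : ∀ᵐ Φ ∂P, Φ.conjTranspose * Φ = 1) {ρ s : ℝ}
    (hρ : 0 < ρ) (hs : s = ρ * Fintype.card τ / Fintype.card μ) :
    mutualInfo (jointLaw (ν := ν) ρ P) ≠ ⊤ ∧
    Integrable (fun x => marginalDensity s P x * Real.log (marginalDensity s P x))
      (gaussianMatrix τ ν) ∧
    (mutualInfo (jointLaw (ν := ν) ρ P)).toReal =
      Fintype.card μ * Fintype.card ν * (s - Real.log (1 + s)) -
        ∫ x, marginalDensity s P x * Real.log (marginalDensity s P x) ∂gaussianMatrix τ ν := by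
  have hs0 : 0 < s := by
    have := Fintype.card_pos (α := τ)
    have := Fintype.card_pos (α := μ)
    rw [hs]
    positivity
  have := isProbabilityMeasure_jointLaw (ν := ν) (P := P) ρ
  obtain ⟨hR, -⟩ := integral_snd_sqNorm_jointLaw (ν := ν) hP hρ
  obtain ⟨hq, hqv⟩ := integral_sqNorm_conjTranspose_mul_jointLaw (ν := ν) hP hρ
  have hZ := measurable_marginalDensity (ν := ν) P s
  obtain ⟨hi1, hi2⟩ := integrable_and_integral_snd_jointLaw (ν := ν) hP hρ
    (Real.measurable_log.comp hZ)
  have hJ := jointLaw_eq_prod_withDensity (ν := ν) hP hρ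
  rw [← hs] at hi1 hi2 hJ hqv
  simp only [Function.comp_apply] at hi1 hi2
  have hlogZ : Integrable (fun p => Real.log (marginalDensity s P p.2))
      (jointLaw (ν := ν) ρ P) := by
    refine Integrable.mono' ((hR.const_mul (s / (1 + s))).add (integrable_const
      (Fintype.card μ * Fintype.card ν * Real.log (1 + s))))
      ((Real.measurable_log.comp (hZ.comp measurable_snd)).aestronglyMeasurable)
      (ae_of_all _ fun p => ?_)
    exact abs_log_marginalDensity_le hP hs0 p.2
  have hZ2 : Measurable fun p : Matrix τ μ ℂ × Matrix τ ν ℂ => marginalDensity s P p.2 :=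
    hZ.comp measurable_snd
  have hLZ : Measurable fun p : Matrix τ μ ℂ × Matrix τ ν ℂ =>
      likelihood s p.1 p.2 / marginalDensity s P p.2 := (measurable_likelihood s).div hZ2
  have hlog : ∀ p : Matrix τ μ ℂ × Matrix τ ν ℂ,
      Real.log (likelihood s p.1 p.2 / marginalDensity s P p.2) =
      (s / (1 + s) * sqNorm (p.1.conjTranspose * p.2) -
        Fintype.card μ * Fintype.card ν * Real.log (1 + s)) -
        Real.log (marginalDensity s P p.2) := by
    intro p
    rw [Real.log_div (likelihood_pos hs0.le _ _).ne' (marginalDensity_pos hP hs0 _).ne',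
      likelihood, Real.log_div (Real.exp_pos _).ne' (by positivity), Real.log_exp, Real.log_pow]
    push_cast
    ring
  have hint1 : Integrable (fun p : Matrix τ μ ℂ × Matrix τ ν ℂ =>
      s / (1 + s) * sqNorm (p.1.conjTranspose * p.2) -
        Fintype.card μ * Fintype.card ν * Real.log (1 + s)) (jointLaw (ν := ν) ρ P) :=
    (hq.const_mul _).sub (integrable_const _)
  obtain ⟨hfin, hval⟩ := klDiv_withDensity_ne_top_and_toReal
    (J := jointLaw (ν := ν) ρ P)
    (Q := (jointLaw (ν := ν) ρ P).fst.prod (jointLaw (ν := ν) ρ P).snd) hLZ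
    (fun p => div_pos (likelihood_pos hs0.le _ _) (marginalDensity_pos hP hs0 _)) hJ
    ((integrable_congr (ae_of_all _ hlog)).2 (hint1.sub hlogZ))
  refine ⟨hfin, hi1.1 hlogZ, ?_⟩
  rw [mutualInfo, hval, integral_congr_ae (ae_of_all _ hlog), integral_sub hint1 hlogZ, hi2,
    integral_sub (hq.const_mul _) (integrable_const _), integral_const_mul, hqv]
  simp only [integral_const, probReal_univ, one_smul]
  have : s / (1 + s) * (Fintype.card μ * Fintype.card ν * (1 + s)) =
      Fintype.card μ * Fintype.card ν * s := by field_simp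
  rw [this]
  ring

end Channel

/-! ### Elementary inequalities with explicit remainders. -/

section RealBounds

theorem abs_log_one_add_sub_le {z : ℝ} (hz : |z| ≤ 1 / 2) :
    |Real.log (1 + z) - (z - z ^ 2 / 2 + z ^ 3 / 3)| ≤ 2 * z ^ 4 := by
  have h := Real.abs_log_sub_add_sum_range_le (x := -z) (by rw [abs_neg]; linarith) 3
  simp only [Finset.sum_range_succ, Finset.sum_range_zero, abs_neg, sub_neg_eq_add] at h
  have h2 : |z| ^ (3 + 1) / (1 - |z|) ≤ 2 * z ^ 4 := by
    rw [show |z| ^ (3 + 1) = z ^ 4 from Even.pow_abs (by decide) z,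
      div_le_iff₀ (by linarith)]
    nlinarith [show 0 ≤ z ^ 4 by positivity]
  refine le_trans (le_of_eq ?_) (h.trans h2)
  congr 1
  push_cast
  ring

/-- The bound must hold for all `z > -1`, because the output density is not uniformly close to one
in `x`. Taylor's formula serves near zero; for `|z| > 1/2` all lower powers are absorbed by `z⁴`. -/
theorem abs_mul_log_sub_le {z : ℝ} (hz : 0 < 1 + z) :
    |(1 + z) * Real.log (1 + z) - (z + z ^ 2 / 2 - z ^ 3 / 6)| ≤ 7 * z ^ 4 := by
  have hz4 : 0 ≤ z ^ 4 := by positivity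
  rcases le_or_gt |z| (1 / 2) with h | h
  · have h1 := abs_log_one_add_sub_le h
    have h2 := abs_le.1 h
    have h3 : (1 + z) * Real.log (1 + z) - (z + z ^ 2 / 2 - z ^ 3 / 6) =
        (1 + z) * (Real.log (1 + z) - (z - z ^ 2 / 2 + z ^ 3 / 3)) + z ^ 4 / 3 := by ring
    rw [h3]
    refine (abs_add_le _ _).trans ?_
    rw [abs_mul, abs_of_pos hz, abs_of_nonneg (by positivity : 0 ≤ z ^ 4 / 3)]
    nlinarith [mul_le_mul (by linarith : 1 + z ≤ 3 / 2) h1 (abs_nonneg _) (by norm_num)]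
  · have h1 : z ≤ (1 + z) * Real.log (1 + z) := by
      have := Real.one_sub_inv_le_log_of_pos hz
      have h2 := mul_le_mul_of_nonneg_left this hz.le
      rw [mul_sub, mul_inv_cancel₀ hz.ne'] at h2
      linarith
    have h2 : (1 + z) * Real.log (1 + z) ≤ z + z ^ 2 := by
      have := mul_le_mul_of_nonneg_left (Real.log_le_sub_one_of_pos hz) hz.le
      nlinarith
    have hsq : z ^ 2 = |z| ^ 2 := (sq_abs z).symm
    have h4 : z ^ 4 = |z| ^ 4 := by rw [← abs_pow, abs_of_nonneg hz4]
    have h3 : |z ^ 3| = |z| ^ 3 := abs_pow z 3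
    have h3' := abs_le.1 h3.le
    have ha : 0 ≤ |z| := abs_nonneg z
    have e2 : |z| ^ 2 ≤ 4 * |z| ^ 4 := by nlinarith [sq_nonneg |z|]
    have e3 : |z| ^ 3 ≤ 2 * |z| ^ 4 := by nlinarith [pow_nonneg ha 3]
    rw [abs_le, h4]
    constructor <;> nlinarith

theorem abs_exp_sub_one_le (u : ℝ) : |Real.exp u - 1| ≤ |u| * Real.exp |u| := by
  have h1 := Real.add_one_le_exp u
  have h2 := Real.add_one_le_exp (-u)
  have h3 : Real.exp u * Real.exp (-u) = 1 := by rw [← Real.exp_add]; simp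
  have hp := Real.exp_pos u
  rcases le_total 0 u with h | h
  · rw [abs_of_nonneg h, abs_of_nonneg (by linarith)]
    nlinarith
  · have h4 : Real.exp u ≤ 1 := Real.exp_le_one_iff.2 h
    have h5 : 1 ≤ Real.exp (-u) := Real.one_le_exp (by linarith)
    rw [abs_of_nonpos h, abs_of_nonpos (by linarith)]
    nlinarith

/-- For either sign, `1 - u ≤ exp(-u)` rearranges to `exp u - 1 - u ≤ u(exp u - 1)`, which reduces
to the first-order bound. -/
theorem abs_exp_sub_one_sub_le (u : ℝ) : |Real.exp u - 1 - u| ≤ u ^ 2 * Real.exp |u| := by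
  have h1 := Real.add_one_le_exp u
  have h2 := Real.add_one_le_exp (-u)
  have h3 : Real.exp u * Real.exp (-u) = 1 := by rw [← Real.exp_add]; simp
  have hp := Real.exp_pos u
  have h4 : Real.exp u - 1 - u ≤ u * (Real.exp u - 1) := by nlinarith
  have h5 : u * (Real.exp u - 1) ≤ |u| * |Real.exp u - 1| := by
    rw [← abs_mul]; exact le_abs_self _
  rw [abs_of_nonneg (by linarith)]
  calc _ ≤ |u| * |Real.exp u - 1| := h4.trans h5
    _ ≤ |u| * (|u| * Real.exp |u|) := by gcongr; exact abs_exp_sub_one_le u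
    _ = u ^ 2 * Real.exp |u| := by rw [← sq_abs u]; ring

/-- First and second order bounds on `exp (s / (1 + s) q) / (1 + s) ^ K` for small `s`. -/
theorem exp_div_pow_bounds {s q R : ℝ} (K : ℕ) (hs : 0 < s) (hs1 : s ≤ 1 / 16) (hq : 0 ≤ q)
    (hqR : q ≤ R) :
    |Real.exp (s / (1 + s) * q) / (1 + s) ^ K - 1| ≤ 16 * s * Real.exp ((R + K) / 8) ∧
    |Real.exp (s / (1 + s) * q) / (1 + s) ^ K - 1 - s * (q - K)| ≤
      528 * s ^ 2 * Real.exp ((R + K) / 8) ∧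
    |q - K| ≤ 16 * Real.exp ((R + K) / 8) := by
  have hl0 : 0 ≤ Real.log (1 + s) := Real.log_nonneg (by linarith)
  have hl1 : Real.log (1 + s) ≤ s := by
    have := Real.log_le_sub_one_of_pos (by linarith : 0 < 1 + s); linarith
  have hfrac : s / (1 + s) = s - s ^ 2 / (1 + s) := by field_simp; ring
  have hfr2 : s ^ 2 / (1 + s) ≤ s ^ 2 := div_le_self (by positivity) (by linarith)
  have hfr3 : 0 ≤ s ^ 2 / (1 + s) := by positivity
  have hl2 : s - s ^ 2 ≤ Real.log (1 + s) := by
    have := Real.one_sub_inv_le_log_of_pos (by linarith : 0 < 1 + s)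
    have h2 : 1 - (1 + s)⁻¹ = s / (1 + s) := by field_simp; ring
    rw [h2, hfrac] at this
    linarith
  have hK : (0:ℝ) ≤ K := Nat.cast_nonneg K
  obtain ⟨u, hu⟩ : ∃ u, u = s / (1 + s) * q - K * Real.log (1 + s) := ⟨_, rfl⟩
  obtain ⟨B, hB⟩ : ∃ B, B = R + K := ⟨_, rfl⟩
  have hB0 : 0 ≤ B := by rw [hB]; linarith
  have hexp : Real.exp (s / (1 + s) * q) / (1 + s) ^ K = Real.exp u := by
    rw [hu, Real.exp_sub, Real.exp_nat_mul, Real.exp_log (by linarith)]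
  have huB : |u| ≤ s * B := by
    have h1 : s / (1 + s) * q ≤ s * R :=
      mul_le_mul (div_le_self hs.le (by linarith)) hqR hq hs.le
    have h2 : 0 ≤ s / (1 + s) * q := by positivity
    have h3 : K * Real.log (1 + s) ≤ K * s := by gcongr
    have h4 : 0 ≤ K * Real.log (1 + s) := by positivity
    have h5 : 0 ≤ s * R := mul_nonneg hs.le (hq.trans hqR)
    rw [abs_le, hu, hB]
    constructor <;> nlinarith
  have hu2 : |u - s * (q - K)| ≤ s ^ 2 * B := by
    have h1 : u - s * (q - K) = -(s ^ 2 / (1 + s) * q) + K * (s - Real.log (1 + s)) := by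
      rw [hu, hfrac]; ring
    have h2 : s ^ 2 / (1 + s) * q ≤ s ^ 2 * R := mul_le_mul hfr2 hqR hq (by positivity)
    have h3 : 0 ≤ s ^ 2 / (1 + s) * q := by positivity
    have h4 : K * (s - Real.log (1 + s)) ≤ K * s ^ 2 := by gcongr; linarith
    have h5 : 0 ≤ K * (s - Real.log (1 + s)) := mul_nonneg hK (by linarith)
    have h6 : 0 ≤ s ^ 2 * R := mul_nonneg (by positivity) (hq.trans hqR)
    rw [abs_le, h1, hB]
    constructor <;> nlinarith
  -- The allowance `exp(B/8)` is split in two: one factor `E` dominates `exp|u|`, as `|u| ≤ sB ≤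
  -- B/16`; the other absorbs `B` or `B²`.
  obtain ⟨E, hE⟩ : ∃ E, E = Real.exp (B / 16) := ⟨_, rfl⟩
  have hE1 : 1 ≤ E := by rw [hE]; exact Real.one_le_exp (by positivity)
  have hEE : Real.exp ((R + K) / 8) = E ^ 2 := by
    rw [hE, ← hB, ← Real.exp_nat_mul]; congr 1; push_cast; ring
  have hBE : B ≤ 16 * E := by
    have := Real.add_one_le_exp (B / 16)
    rw [← hE] at this
    linarith
  have hBE2 : B ^ 2 ≤ 512 * E := by
    have := Real.quadratic_le_exp_of_nonneg (by positivity : 0 ≤ B / 16)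
    rw [← hE] at this
    nlinarith
  have huE : Real.exp |u| ≤ E := by
    rw [hE]
    refine Real.exp_le_exp.2 (huB.trans ?_)
    nlinarith
  have hEsq : E ≤ E ^ 2 := by nlinarith
  rw [hexp, hEE]
  refine ⟨?_, ?_, ?_⟩
  · calc _ ≤ |u| * Real.exp |u| := abs_exp_sub_one_le u
      _ ≤ (s * B) * E := by gcongr
      _ ≤ (s * (16 * E)) * E := by gcongr
      _ = _ := by ring
  · have h1 : Real.exp u - 1 - s * (q - K) = (Real.exp u - 1 - u) + (u - s * (q - K)) := by ring
    rw [h1]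
    refine (abs_add_le _ _).trans ?_
    have h2 : |Real.exp u - 1 - u| ≤ 512 * s ^ 2 * E ^ 2 := by
      calc _ ≤ u ^ 2 * Real.exp |u| := abs_exp_sub_one_sub_le u
        _ = |u| ^ 2 * Real.exp |u| := by rw [sq_abs]
        _ ≤ (s * B) ^ 2 * E := by gcongr
        _ = s ^ 2 * B ^ 2 * E := by ring
        _ ≤ s ^ 2 * (512 * E) * E := by gcongr
        _ = _ := by ring
    have h3 : s ^ 2 * B ≤ s ^ 2 * (16 * E ^ 2) := by gcongr; linarith
    linarith
  · have : |q - K| ≤ B := by rw [abs_le, hB]; constructor <;> linarith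
    linarith

/-- Since `z² = 2szw - s²w² + (z - sw)²`, the square can be traded for a term linear in `z` at a
cost of order `s⁴`. This avoids any second-order expansion of the output density, which would
involve fourth moments of the input. -/
theorem abs_mul_log_sub_quadratic_le {s z w G : ℝ} (hz : 0 < 1 + z) (hs : 0 < s) (hG : 1 ≤ G)
    (h0 : |z| ≤ 16 * s * G) (h1 : |z - s * w| ≤ 528 * s ^ 2 * G) (hw : |w| ≤ 16 * G) :
    |(1 + z) * Real.log (1 + z) -
      (z + (s * (z * w) - s ^ 2 / 2 * w ^ 2) - s ^ 3 / 6 * w ^ 3)| ≤ 1000000 * s ^ 4 * G ^ 4 := by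
  have hG0 : 0 ≤ G := by linarith
  have a1 := abs_mul_log_sub_le hz
  have a2 : z ^ 4 ≤ (16 * s * G) ^ 4 := by
    rw [show z ^ 4 = |z| ^ 4 by rw [← abs_pow]; exact (abs_of_nonneg (by positivity)).symm]
    gcongr
  have a3 : (z - s * w) ^ 2 ≤ (528 * s ^ 2 * G) ^ 2 := by
    rw [← sq_abs (z - s * w)]
    gcongr
  have hsw : |s * w| ≤ 16 * s * G := by
    rw [abs_mul, abs_of_pos hs]
    nlinarith
  have a4 : |(z - s * w) * (z ^ 2 + z * (s * w) + (s * w) ^ 2)| ≤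
      (528 * s ^ 2 * G) * (3 * (16 * s * G) ^ 2) := by
    rw [abs_mul]
    refine mul_le_mul h1 ?_ (abs_nonneg _) (by positivity)
    have b1 : z ^ 2 ≤ (16 * s * G) ^ 2 := by rw [← sq_abs z]; gcongr
    have b2 : (s * w) ^ 2 ≤ (16 * s * G) ^ 2 := by rw [← sq_abs (s * w)]; gcongr
    have b3 : |z * (s * w)| ≤ (16 * s * G) ^ 2 := by
      rw [abs_mul, sq]
      gcongr
    have b4 := abs_le.1 b3
    rw [abs_le]
    constructor <;> nlinarith [sq_nonneg z, sq_nonneg (s * w)]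
  have key : (1 + z) * Real.log (1 + z) -
      (z + (s * (z * w) - s ^ 2 / 2 * w ^ 2) - s ^ 3 / 6 * w ^ 3) =
      ((1 + z) * Real.log (1 + z) - (z + z ^ 2 / 2 - z ^ 3 / 6)) + (z - s * w) ^ 2 / 2 -
        (z - s * w) * (z ^ 2 + z * (s * w) + (s * w) ^ 2) / 6 := by ring
  have g2 : G ^ 2 ≤ G ^ 4 := pow_le_pow_right₀ hG (by norm_num)
  have g3 : G ^ 3 ≤ G ^ 4 := pow_le_pow_right₀ hG (by norm_num)
  have s4 : 0 ≤ s ^ 4 := by positivity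
  have c2 := mul_le_mul_of_nonneg_left g2 s4
  have c3 := mul_le_mul_of_nonneg_left g3 s4
  have d1 := abs_le.1 a1
  have d4 := abs_le.1 a4
  have e3 : (528 * s ^ 2 * G) ^ 2 = 278784 * (s ^ 4 * G ^ 2) := by ring
  have e4 : (528 * s ^ 2 * G) * (3 * (16 * s * G) ^ 2) = 405504 * (s ^ 4 * G ^ 3) := by ring
  have e2 : (16 * s * G) ^ 4 = 65536 * (s ^ 4 * G ^ 4) := by ring
  rw [e2] at a2
  rw [e3] at a3
  rw [e4] at d4
  rw [key, abs_le]
  constructor <;> nlinarith [sq_nonneg (z - s * w)]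

end RealBounds

/-! ### Third-order expansion of the mutual information. -/

section Expansion

variable {τ μ ν : Type*} [Fintype τ] [Fintype μ] [Fintype ν] [DecidableEq μ]
  {P : Measure (Matrix τ μ ℂ)} [IsProbabilityMeasure P]

theorem integrable_sqNorm_conjTranspose_mul (hP : ∀ᵐ Φ ∂P, Φ.conjTranspose * Φ = 1)
    (x : Matrix τ ν ℂ) : Integrable (fun Φ => sqNorm (Φ.conjTranspose * x)) P := by
  have hm : Measurable fun Φ : Matrix τ μ ℂ => sqNorm (Φ.conjTranspose * x) := by
    simp only [sqNorm, Matrix.mul_apply, Matrix.conjTranspose_apply]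
    fun_prop
  refine Integrable.mono' (integrable_const (sqNorm x)) hm.aestronglyMeasurable ?_
  filter_upwards [hP] with Φ hΦ
  rw [Real.norm_of_nonneg (sqNorm_nonneg _)]
  exact sqNorm_conjTranspose_mul_le hΦ x

/-- First and second order bounds on the marginal density, for an input law with isotropic
second moments. -/
theorem marginalDensity_bounds (hP : ∀ᵐ Φ ∂P, Φ.conjTranspose * Φ = 1) {κ : ℝ}
    (hκ : ∀ x : Matrix τ ν ℂ, ∫ Φ, sqNorm (Φ.conjTranspose * x) ∂P = κ * sqNorm x) {s : ℝ}
    (hs : 0 < s) (hs1 : s ≤ 1 / 16) (x : Matrix τ ν ℂ) :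
    |marginalDensity s P x - 1| ≤
      16 * s * Real.exp ((sqNorm x + (Fintype.card μ * Fintype.card ν : ℕ)) / 8) ∧
    |marginalDensity s P x - 1 - s * (κ * sqNorm x - (Fintype.card μ * Fintype.card ν : ℕ))| ≤
      528 * s ^ 2 * Real.exp ((sqNorm x + (Fintype.card μ * Fintype.card ν : ℕ)) / 8) ∧
    |κ * sqNorm x - (Fintype.card μ * Fintype.card ν : ℕ)| ≤
      16 * Real.exp ((sqNorm x + (Fintype.card μ * Fintype.card ν : ℕ)) / 8) := by
  -- The bounds are uniform in `Φ`, with `R = |x|²`, so they survive averaging. Isotropy turns the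
  -- mean of `|Φᴴx|²` into `κ|x|²`.
  have hb : ∀ᵐ Φ ∂P, _ := hP.mono fun Φ hΦ => exp_div_pow_bounds
    (Fintype.card μ * Fintype.card ν) hs hs1 (sqNorm_nonneg (Φ.conjTranspose * x))
    (sqNorm_conjTranspose_mul_le hΦ x)
  have hL := (likelihood_le_and_integrable hP hs x).2
  have hq := integrable_sqNorm_conjTranspose_mul hP x
  have hqK : Integrable (fun Φ => sqNorm (Φ.conjTranspose * x) -
      (Fintype.card μ * Fintype.card ν : ℕ)) P := hq.sub (integrable_const _)
  have hL1 : Integrable (fun Φ => likelihood s Φ x - 1) P := hL.sub (integrable_const _)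
  have e1 : marginalDensity s P x - 1 = ∫ Φ, (likelihood s Φ x - 1) ∂P := by
    rw [integral_sub hL (integrable_const _)]
    simp [marginalDensity]
  have e3 : κ * sqNorm x - (Fintype.card μ * Fintype.card ν : ℕ) =
      ∫ Φ, (sqNorm (Φ.conjTranspose * x) - (Fintype.card μ * Fintype.card ν : ℕ)) ∂P := by
    rw [integral_sub hq (integrable_const _), hκ]
    simp
  have e2 : marginalDensity s P x - 1 -
      s * (κ * sqNorm x - (Fintype.card μ * Fintype.card ν : ℕ)) =
      ∫ Φ, (likelihood s Φ x - 1 - s * (sqNorm (Φ.conjTranspose * x) -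
        (Fintype.card μ * Fintype.card ν : ℕ))) ∂P := by
    rw [integral_sub hL1 (hqK.const_mul s), integral_const_mul, ← e1, ← e3]
  refine ⟨?_, ?_, ?_⟩
  · rw [e1, ← Real.norm_eq_abs]
    exact le_of_le_of_eq (norm_integral_le_of_norm_le_const (hb.mono fun Φ h => h.1))
      (by rw [probReal_univ, mul_one])
  · rw [e2, ← Real.norm_eq_abs]
    exact le_of_le_of_eq (norm_integral_le_of_norm_le_const (hb.mono fun Φ h => h.2.1))
      (by rw [probReal_univ, mul_one])
  · rw [e3, ← Real.norm_eq_abs]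
    exact le_of_le_of_eq (norm_integral_le_of_norm_le_const (hb.mono fun Φ h => h.2.2))
      (by rw [probReal_univ, mul_one])

variable [Nonempty μ] [Nonempty τ]

theorem integral_marginalDensity (hP : ∀ᵐ Φ ∂P, Φ.conjTranspose * Φ = 1) {s : ℝ} (hs : 0 < s) :
    (Integrable (fun x => marginalDensity s P x) (gaussianMatrix τ ν) ∧
      ∫ x, marginalDensity s P x ∂gaussianMatrix τ ν = 1) ∧
    (Integrable (fun x => marginalDensity s P x * sqNorm x) (gaussianMatrix τ ν) ∧
      ∫ x, marginalDensity s P x * sqNorm x ∂gaussianMatrix τ ν =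
        s * (Fintype.card μ * Fintype.card ν) + Fintype.card τ * Fintype.card ν) := by
  have hc1 : (0 : ℝ) < Fintype.card τ := Nat.cast_pos.2 Fintype.card_pos
  have hc2 : (0 : ℝ) < Fintype.card μ := Nat.cast_pos.2 Fintype.card_pos
  -- This is the signal-to-noise ratio whose channel parameter is `s`.
  have hρ : 0 < s * Fintype.card μ / Fintype.card τ := by positivity
  have hsρ : s * Fintype.card μ / Fintype.card τ * Fintype.card τ / Fintype.card μ = s := by
    field_simp
  have := isProbabilityMeasure_jointLaw (ν := ν) (P := P) (s * Fintype.card μ / Fintype.card τ)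
  obtain ⟨a1, a2⟩ := integrable_and_integral_snd_jointLaw (ν := ν) hP hρ
    (g := fun _ => (1 : ℝ)) measurable_const
  obtain ⟨b1, b2⟩ := integrable_and_integral_snd_jointLaw (ν := ν) hP hρ measurable_sqNorm
  obtain ⟨c1, c2⟩ := integral_snd_sqNorm_jointLaw (ν := ν) hP hρ
  rw [hsρ] at a1 a2 b1 b2 c2
  simp only [mul_one] at a1 a2
  refine ⟨⟨a1.1 (integrable_const _), ?_⟩, b1.1 c1, b2 ▸ c2⟩
  rw [← a2]
  simp

/-- With `K = κTN`, the variable `w` is a centred Gamma variable scaled by `κ`, so `E w² = κK` and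
`E w³ = 2κ²K`. The output energy gives `∫ zw = sκK`, and `∫ z = 0`. -/
theorem integral_marginalDensity_quadratic (hP : ∀ᵐ Φ ∂P, Φ.conjTranspose * Φ = 1) {s : ℝ}
    (hs : 0 < s) (κ : ℝ) (hK : (Fintype.card μ * Fintype.card ν : ℝ) =
      κ * (Fintype.card τ * Fintype.card ν)) :
    Integrable (fun x => (marginalDensity s P x - 1) +
      (s * ((marginalDensity s P x - 1) *
        (κ * sqNorm x - (Fintype.card μ * Fintype.card ν : ℕ))) -
        s ^ 2 / 2 * (κ * sqNorm x - (Fintype.card μ * Fintype.card ν : ℕ)) ^ 2) -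
      s ^ 3 / 6 * (κ * sqNorm x - (Fintype.card μ * Fintype.card ν : ℕ)) ^ 3)
      (gaussianMatrix τ ν) ∧
    ∫ x, ((marginalDensity s P x - 1) +
      (s * ((marginalDensity s P x - 1) *
        (κ * sqNorm x - (Fintype.card μ * Fintype.card ν : ℕ))) -
        s ^ 2 / 2 * (κ * sqNorm x - (Fintype.card μ * Fintype.card ν : ℕ)) ^ 2) -
      s ^ 3 / 6 * (κ * sqNorm x - (Fintype.card μ * Fintype.card ν : ℕ)) ^ 3)
      ∂gaussianMatrix τ ν =
      Fintype.card μ * Fintype.card ν * (s ^ 2 * κ / 2 - s ^ 3 * κ ^ 2 / 3) := by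
  obtain ⟨⟨i1, v1⟩, i2, v2⟩ := integral_marginalDensity (ν := ν) hP hs
  have r1 := integrable_sqNorm_pow (m := τ) (n := ν) 1
  have r2 := integrable_sqNorm_pow (m := τ) (n := ν) 2
  have r3 := integrable_sqNorm_pow (m := τ) (n := ν) 3
  have w1 := integral_sqNorm_pow (m := τ) (n := ν) 1
  have w2 := integral_sqNorm_pow (m := τ) (n := ν) 2
  have w3 := integral_sqNorm_pow (m := τ) (n := ν) 3
  simp only [Nat.ascFactorial, pow_one] at r1 w1 w2 w3
  push_cast at w1 w2 w3 ⊢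
  rw [hK] at v2 ⊢
  obtain ⟨d, hd⟩ : ∃ d : ℝ, d = Fintype.card τ * Fintype.card ν := ⟨_, rfl⟩
  rw [← hd] at v2 w1 w2 w3 ⊢
  have key : ∀ x : Matrix τ ν ℂ, (marginalDensity s P x - 1) +
      (s * ((marginalDensity s P x - 1) * (κ * sqNorm x - κ * d)) -
        s ^ 2 / 2 * (κ * sqNorm x - κ * d) ^ 2) - s ^ 3 / 6 * (κ * sqNorm x - κ * d) ^ 3 =
      (1 - s * κ * d) * marginalDensity s P x + s * κ * (marginalDensity s P x * sqNorm x) +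
      (-s * κ + s ^ 2 * κ ^ 2 * d - s ^ 3 * κ ^ 3 * d ^ 2 / 2) * sqNorm x +
      (-s ^ 2 * κ ^ 2 / 2 + s ^ 3 * κ ^ 3 * d / 2) * sqNorm x ^ 2 +
      (-s ^ 3 * κ ^ 3 / 6) * sqNorm x ^ 3 +
      (-1 + s * κ * d - s ^ 2 * κ ^ 2 * d ^ 2 / 2 + s ^ 3 * κ ^ 3 * d ^ 3 / 6) := fun x => by ring
  have j1 := i1.const_mul (1 - s * κ * d)
  have j2 : Integrable (fun x => _) _ := j1.add (i2.const_mul (s * κ))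
  have j3 : Integrable (fun x => _) _ :=
    j2.add (r1.const_mul (-s * κ + s ^ 2 * κ ^ 2 * d - s ^ 3 * κ ^ 3 * d ^ 2 / 2))
  have j4 : Integrable (fun x => _) _ :=
    j3.add (r2.const_mul (-s ^ 2 * κ ^ 2 / 2 + s ^ 3 * κ ^ 3 * d / 2))
  have j5 : Integrable (fun x => _) _ := j4.add (r3.const_mul (-s ^ 3 * κ ^ 3 / 6))
  simp only [Pi.add_apply] at j2 j3 j4 j5
  simp_rw [key]
  refine ⟨j5.add (integrable_const _), ?_⟩
  rw [integral_add j5 (integrable_const _), integral_add j4 (r3.const_mul _),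
    integral_add j3 (r2.const_mul _), integral_add j2 (r1.const_mul _),
    integral_add j1 (i2.const_mul _)]
  simp only [integral_const_mul, v1, v2, w1, w2, w3, integral_const, probReal_univ, one_smul]
  ring

theorem abs_mutualInfo_sub_le (hP : ∀ᵐ Φ ∂P, Φ.conjTranspose * Φ = 1)
    (hiso : ∀ x : Matrix τ ν ℂ, ∫ Φ, sqNorm (Φ.conjTranspose * x) ∂P =
      Fintype.card μ / Fintype.card τ * sqNorm x) :
    ∃ C : ℝ, ∀ ρ s : ℝ, 0 < ρ → s = ρ * Fintype.card τ / Fintype.card μ → s ≤ 1 / 16 →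
      |(mutualInfo (jointLaw (ν := ν) ρ P)).toReal -
        Fintype.card μ * Fintype.card ν * (s ^ 2 / 2 * (1 - Fintype.card μ / Fintype.card τ) -
          s ^ 3 / 3 * (1 - (Fintype.card μ / Fintype.card τ) ^ 2))| ≤ C * s ^ 4 := by
  have hc1 : (0 : ℝ) < Fintype.card τ := Nat.cast_pos.2 Fintype.card_pos
  have hc2 : (0 : ℝ) < Fintype.card μ := Nat.cast_pos.2 Fintype.card_pos
  obtain ⟨κ, hκ⟩ : ∃ κ : ℝ, κ = Fintype.card μ / Fintype.card τ := ⟨_, rfl⟩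
  have hK : (Fintype.card μ * Fintype.card ν : ℝ) = κ * (Fintype.card τ * Fintype.card ν) := by
    rw [hκ]; field_simp
  rw [← hκ] at hiso ⊢
  -- The remainder carries the fourth power of `exp((|x|² + K)/8)`. The resulting rate `1/2` is
  -- below the critical value `1`, so this integral is finite.
  obtain ⟨E, hE⟩ : ∃ E : ℝ, E = ∫ x, Real.exp ((sqNorm x + (Fintype.card μ *
    Fintype.card ν : ℕ)) / 2) ∂gaussianMatrix τ ν := ⟨_, rfl⟩
  have hEint : Integrable (fun x => Real.exp ((sqNorm x + (Fintype.card μ *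
      Fintype.card ν : ℕ)) / 2)) (gaussianMatrix τ ν) := by
    have := (integrable_exp_sqNorm_gaussianMatrix (m := τ) (n := ν) (t := 1 / 2)
      (by norm_num)).mul_const (Real.exp ((Fintype.card μ * Fintype.card ν : ℕ) / 2))
    refine (integrable_congr (ae_of_all _ fun x => ?_)).2 this
    rw [← Real.exp_add]
    ring_nf
  refine ⟨Fintype.card μ * Fintype.card ν * 2 + 1000000 * E, fun ρ s hρ hs hs1 => ?_⟩
  have hs0 : 0 < s := by rw [hs]; positivity
  obtain ⟨-, hZint, hI⟩ := mutualInfo_jointLaw (ν := ν) hP hρ hs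
  obtain ⟨hQint, hQ⟩ := integral_marginalDensity_quadratic (ν := ν) hP hs0 κ hK
  have hpt : ∀ x : Matrix τ ν ℂ, ‖marginalDensity s P x * Real.log (marginalDensity s P x) -
      ((marginalDensity s P x - 1) + (s * ((marginalDensity s P x - 1) *
        (κ * sqNorm x - (Fintype.card μ * Fintype.card ν : ℕ))) -
        s ^ 2 / 2 * (κ * sqNorm x - (Fintype.card μ * Fintype.card ν : ℕ)) ^ 2) -
      s ^ 3 / 6 * (κ * sqNorm x - (Fintype.card μ * Fintype.card ν : ℕ)) ^ 3)‖ ≤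
      1000000 * s ^ 4 * Real.exp ((sqNorm x + (Fintype.card μ * Fintype.card ν : ℕ)) / 2) := by
    intro x
    obtain ⟨b1, b2, b3⟩ := marginalDensity_bounds hP hiso hs0 hs1 x
    have h := abs_mul_log_sub_quadratic_le
      (by rw [add_sub_cancel]; exact marginalDensity_pos hP hs0 x) hs0
      (Real.one_le_exp (div_nonneg (add_nonneg (sqNorm_nonneg x) (Nat.cast_nonneg _))
        (by norm_num))) b1 b2 b3
    rw [add_sub_cancel, ← Real.exp_nat_mul] at h
    refine h.trans_eq ?_
    congr 2
    push_cast
    ring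
  have hbound := norm_integral_le_of_norm_le (hEint.const_mul (1000000 * s ^ 4))
    (ae_of_all _ hpt)
  rw [integral_sub hZint hQint, hQ, integral_const_mul, ← hE, Real.norm_eq_abs] at hbound
  have hlog := abs_log_one_add_sub_le (z := s) (by rw [abs_of_pos hs0]; linarith)
  have hlog' : |(Fintype.card μ * Fintype.card ν : ℝ) *
      (Real.log (1 + s) - (s - s ^ 2 / 2 + s ^ 3 / 3))| ≤
      Fintype.card μ * Fintype.card ν * (2 * s ^ 4) := by
    rw [abs_mul, abs_of_nonneg (by positivity : (0:ℝ) ≤ Fintype.card μ * Fintype.card ν)]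
    gcongr
  rw [hI]
  have e : ∀ A : ℝ, (Fintype.card μ * Fintype.card ν * (s - Real.log (1 + s)) - A) -
      Fintype.card μ * Fintype.card ν * (s ^ 2 / 2 * (1 - κ) - s ^ 3 / 3 * (1 - κ ^ 2)) =
      -(Fintype.card μ * Fintype.card ν * (Real.log (1 + s) - (s - s ^ 2 / 2 + s ^ 3 / 3))) -
      (A - Fintype.card μ * Fintype.card ν * (s ^ 2 * κ / 2 - s ^ 3 * κ ^ 2 / 3)) := fun A => by
    ring
  rw [e]
  refine (abs_sub _ _).trans ?_
  rw [abs_neg]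
  refine (add_le_add hlog' hbound).trans_eq ?_
  ring

end Expansion

/-! ### Second moments of Haar unitary entries. -/

section Haar

variable {n : ℕ}

instance isProbabilityMeasure_haarUnitary : IsProbabilityMeasure (haarUnitary n) :=
  ⟨Measure.haarMeasure_self⟩

instance isMulLeftInvariant_haarUnitary : (haarUnitary n).IsMulLeftInvariant :=
  inferInstanceAs (Measure.haarMeasure _).IsMulLeftInvariant

theorem integrable_haarUnitary {E : Type*} [NormedAddCommGroup E]
    {f : Matrix.unitaryGroup (Fin n) ℂ → E} (hf : Continuous f) :
    Integrable f (haarUnitary n) :=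
  hf.integrable_of_hasCompactSupport (HasCompactSupport.of_compactSpace f)

theorem continuous_unitary_entry (i k : Fin n) :
    Continuous fun U : Matrix.unitaryGroup (Fin n) ℂ => (U : Matrix (Fin n) (Fin n) ℂ) i k :=
  continuous_subtype_val.matrix_elem i k

/-- Left multiplication by the diagonal matrix that flips the sign of row `i` preserves Haar measure
and negates the integrand. -/
theorem integral_star_mul_haarUnitary_of_ne {i i' : Fin n} (h : i ≠ i') (k : Fin n) :
    ∫ U, star ((U : Matrix (Fin n) (Fin n) ℂ) i k) * (U : Matrix (Fin n) (Fin n) ℂ) i' k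
      ∂haarUnitary n = 0 := by
  have hD : Matrix.diagonal (fun j : Fin n => if j = i then (-1 : ℂ) else 1) ∈
      Matrix.unitaryGroup (Fin n) ℂ := by
    rw [Matrix.mem_unitaryGroup_iff, Matrix.star_eq_conjTranspose,
      Matrix.diagonal_conjTranspose, Matrix.diagonal_mul_diagonal, ← Matrix.diagonal_one]
    congr 1
    funext j
    by_cases hj : j = i <;> simp [hj]
  have key := integral_mul_left_eq_self (μ := haarUnitary n) (fun U : Matrix.unitaryGroup (Fin n) ℂ =>
    star ((U : Matrix (Fin n) (Fin n) ℂ) i k) * (U : Matrix (Fin n) (Fin n) ℂ) i' k) ⟨_, hD⟩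
  simp only [Submonoid.coe_mul, Matrix.diagonal_mul, if_neg h.symm, if_true, neg_mul, one_mul,
    star_neg, integral_neg] at key
  exact self_eq_neg.1 key.symm

/-- Row swaps make the value independent of `i`, and each column has unit norm. -/
theorem integral_norm_sq_haarUnitary (i k : Fin n) :
    ∫ U, ‖(U : Matrix (Fin n) (Fin n) ℂ) i k‖ ^ 2 ∂haarUnitary n = (n : ℝ)⁻¹ := by
  have hint : ∀ i, Integrable (fun U : Matrix.unitaryGroup (Fin n) ℂ =>
      ‖(U : Matrix (Fin n) (Fin n) ℂ) i k‖ ^ 2) (haarUnitary n) := fun i =>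
    integrable_haarUnitary ((continuous_unitary_entry i k).norm.pow 2)
  have hperm : ∀ i', ∫ U, ‖(U : Matrix (Fin n) (Fin n) ℂ) i' k‖ ^ 2 ∂haarUnitary n =
      ∫ U, ‖(U : Matrix (Fin n) (Fin n) ℂ) i k‖ ^ 2 ∂haarUnitary n := by
    intro i'
    have hS : (Equiv.swap i i').toPEquiv.toMatrix ∈ Matrix.unitaryGroup (Fin n) ℂ := by
      rw [Matrix.mem_unitaryGroup_iff, Matrix.star_eq_conjTranspose]
      ext a b
      simp [PEquiv.toMatrix_toPEquiv_mul, PEquiv.toMatrix_apply, Matrix.one_apply]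
    have key := integral_mul_left_eq_self (μ := haarUnitary n)
      (fun U : Matrix.unitaryGroup (Fin n) ℂ => ‖(U : Matrix (Fin n) (Fin n) ℂ) i k‖ ^ 2) ⟨_, hS⟩
    simpa [PEquiv.toMatrix_toPEquiv_mul] using key
  have hsum : ∑ i', ∫ U, ‖(U : Matrix (Fin n) (Fin n) ℂ) i' k‖ ^ 2 ∂haarUnitary n = 1 := by
    rw [← integral_finsetSum _ fun i _ => hint i]
    have : ∀ U : Matrix.unitaryGroup (Fin n) ℂ,
        ∑ i', ‖(U : Matrix (Fin n) (Fin n) ℂ) i' k‖ ^ 2 = 1 := by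
      intro U
      have h := congrFun (congrFun (Matrix.mem_unitaryGroup_iff'.1 U.2) k) k
      rw [Matrix.star_eq_conjTranspose, Matrix.mul_apply] at h
      apply Complex.ofReal_injective
      push_cast
      simpa [Matrix.conjTranspose_apply, Complex.conj_mul'] using h
    simp [this]
  simp only [hperm, Finset.sum_const, Finset.card_univ, Fintype.card_fin, nsmul_eq_mul] at hsum
  exact eq_inv_of_mul_eq_one_right hsum

theorem integral_norm_sq_sum_haarUnitary (k : Fin n) (y : Fin n → ℂ) :
    ∫ U, ‖∑ i, star ((U : Matrix (Fin n) (Fin n) ℂ) i k) * y i‖ ^ 2 ∂haarUnitary n =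
      (n : ℝ)⁻¹ * ∑ i, ‖y i‖ ^ 2 := by
  have hexp : ∀ U : Matrix.unitaryGroup (Fin n) ℂ,
      ((‖∑ i, star ((U : Matrix (Fin n) (Fin n) ℂ) i k) * y i‖ ^ 2 : ℝ) : ℂ) =
      ∑ i, ∑ i', star ((U : Matrix (Fin n) (Fin n) ℂ) i k) *
        (U : Matrix (Fin n) (Fin n) ℂ) i' k * (y i * star (y i')) := by
    intro U
    push_cast
    rw [← Complex.mul_conj', map_sum, Finset.sum_mul_sum]
    refine Finset.sum_congr rfl fun i _ => Finset.sum_congr rfl fun i' _ => ?_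
    simp
    ring
  have hint : ∀ i i', Integrable (fun U : Matrix.unitaryGroup (Fin n) ℂ =>
      star ((U : Matrix (Fin n) (Fin n) ℂ) i k) * (U : Matrix (Fin n) (Fin n) ℂ) i' k *
        (y i * star (y i'))) (haarUnitary n) := fun i i' =>
    integrable_haarUnitary (((continuous_star.comp (continuous_unitary_entry i k)).mul
      (continuous_unitary_entry i' k)).mul continuous_const)
  have hdiag : ∀ i, ∫ U, star ((U : Matrix (Fin n) (Fin n) ℂ) i k) *
      (U : Matrix (Fin n) (Fin n) ℂ) i k ∂haarUnitary n = ((n : ℝ)⁻¹ : ℝ) := by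
    intro i
    rw [← integral_norm_sq_haarUnitary i k, ← integral_complex_ofReal]
    refine integral_congr_ae (ae_of_all _ fun U => ?_)
    simp [Complex.conj_mul']
  apply Complex.ofReal_injective
  rw [← integral_complex_ofReal]
  simp_rw [hexp]
  rw [integral_finsetSum _ fun i _ => integrable_finsetSum _ fun i' _ => hint i i']
  push_cast
  rw [Finset.mul_sum]
  refine Finset.sum_congr rfl fun i _ => ?_
  rw [integral_finsetSum _ fun i' _ => hint i i', Finset.sum_eq_single i]
  · rw [integral_mul_const, hdiag, ← Complex.mul_conj']
    simp
  · intro i' _ hne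
    rw [integral_mul_const, integral_star_mul_haarUnitary_of_ne hne.symm, zero_mul]
  · simp

end Haar

/-! ### Orthonormality and isotropic second moments of the two inputs. -/

section Inputs

theorem measurableSet_isometry {τ μ : Type*} [Fintype τ] [Fintype μ] [DecidableEq μ] :
    MeasurableSet {Φ : Matrix τ μ ℂ | Φ.conjTranspose * Φ = 1} :=
  (isClosed_eq (by fun_prop) continuous_const).measurableSet

theorem measurable_sqNorm_conjTranspose_mul_left {τ μ ν : Type*} [Fintype τ] [Fintype μ]
    [Fintype ν] (x : Matrix τ ν ℂ) :
    Measurable fun Φ : Matrix τ μ ℂ => sqNorm (Φ.conjTranspose * x) := by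
  simp only [sqNorm, Matrix.mul_apply, Matrix.conjTranspose_apply]
  fun_prop

theorem measurable_ustm (T M : ℕ) :
    Measurable fun U : Matrix.unitaryGroup (Fin T) ℂ =>
      (U : Matrix (Fin T) (Fin T) ℂ) * stiefelBase T M :=
  (continuous_subtype_val.matrix_mul continuous_const).measurable

theorem measurable_dustm (M : ℕ) :
    Measurable fun U : Matrix.unitaryGroup (Fin M) ℂ => (((Real.sqrt 2)⁻¹ : ℝ) : ℂ) •
      Matrix.fromRows (1 : Matrix (Fin M) (Fin M) ℂ) (U : Matrix (Fin M) (Fin M) ℂ) := by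
  have hc : Continuous fun U : Matrix.unitaryGroup (Fin M) ℂ =>
      Matrix.fromRows (1 : Matrix (Fin M) (Fin M) ℂ) (U : Matrix (Fin M) (Fin M) ℂ) := by
    refine continuous_matrix fun i j => ?_
    rcases i with i | i
    · exact continuous_const
    · exact continuous_unitary_entry i j
  have : Continuous fun U : Matrix.unitaryGroup (Fin M) ℂ => (((Real.sqrt 2)⁻¹ : ℝ) : ℂ) •
      Matrix.fromRows (1 : Matrix (Fin M) (Fin M) ℂ) (U : Matrix (Fin M) (Fin M) ℂ) :=
    hc.const_smul (((Real.sqrt 2)⁻¹ : ℝ) : ℂ)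
  exact this.measurable

instance isProbabilityMeasure_ustmInput (T M : ℕ) : IsProbabilityMeasure (ustmInput T M) :=
  Measure.isProbabilityMeasure_map (measurable_ustm T M).aemeasurable

instance isProbabilityMeasure_dustmInput (M : ℕ) : IsProbabilityMeasure (dustmInput M) :=
  Measure.isProbabilityMeasure_map (measurable_dustm M).aemeasurable

theorem mul_stiefelBase_apply {T M : ℕ} (h : M ≤ T) (A : Matrix (Fin T) (Fin T) ℂ) (i : Fin T)
    (k : Fin M) : (A * stiefelBase T M) i k = A i (Fin.castLE h k) := by
  rw [Matrix.mul_apply, Finset.sum_eq_single (Fin.castLE h k)]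
  · simp [stiefelBase]
  · intro j _ hj
    have : (j : ℕ) ≠ k := fun hjk => hj (Fin.ext hjk)
    simp [stiefelBase, this]
  · simp

theorem ustmInput_isometry {T M : ℕ} (h : M ≤ T) :
    ∀ᵐ Φ ∂ustmInput T M, Φ.conjTranspose * Φ = 1 := by
  refine (ae_map_iff (measurable_ustm T M).aemeasurable measurableSet_isometry).2
    (ae_of_all _ fun U => ?_)
  ext k k'
  have hU := congrFun (congrFun (Matrix.mem_unitaryGroup_iff'.1 U.2) (Fin.castLE h k))
    (Fin.castLE h k')
  rw [Matrix.star_eq_conjTranspose, Matrix.mul_apply] at hU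
  rw [Matrix.mul_apply]
  simp only [Matrix.conjTranspose_apply, mul_stiefelBase_apply h] at hU ⊢
  rw [hU]
  simp [Matrix.one_apply, Fin.ext_iff]

theorem integral_sqNorm_ustmInput {T M N : ℕ} (h : M ≤ T) (x : Matrix (Fin T) (Fin N) ℂ) :
    ∫ Φ, sqNorm (Φ.conjTranspose * x) ∂ustmInput T M =
      Fintype.card (Fin M) / Fintype.card (Fin T) * sqNorm x := by
  rw [ustmInput, integral_map (measurable_ustm T M).aemeasurable
    (measurable_sqNorm_conjTranspose_mul_left x).aestronglyMeasurable]
  have hexp : ∀ U : Matrix.unitaryGroup (Fin T) ℂ,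
      sqNorm (((U : Matrix (Fin T) (Fin T) ℂ) * stiefelBase T M).conjTranspose * x) =
      ∑ k : Fin M, ∑ j,
        ‖∑ i, star ((U : Matrix (Fin T) (Fin T) ℂ) i (Fin.castLE h k)) * x i j‖ ^ 2 := by
    intro U
    refine Finset.sum_congr rfl fun k _ => Finset.sum_congr rfl fun j _ => ?_
    rw [Matrix.mul_apply]
    simp only [Matrix.conjTranspose_apply, mul_stiefelBase_apply h]
  simp_rw [hexp]
  have hint : ∀ (k : Fin M) (j : Fin N), Integrable (fun U : Matrix.unitaryGroup (Fin T) ℂ =>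
      ‖∑ i, star ((U : Matrix (Fin T) (Fin T) ℂ) i (Fin.castLE h k)) * x i j‖ ^ 2)
      (haarUnitary T) := fun k j =>
    integrable_haarUnitary ((continuous_finsetSum _ fun i _ => (continuous_star.comp
      (continuous_unitary_entry i (Fin.castLE h k))).mul continuous_const).norm.pow 2)
  rw [integral_finsetSum _ fun k _ => integrable_finsetSum _ fun j _ => hint k j]
  simp only [integral_finsetSum _ fun j _ => hint _ j, integral_norm_sq_sum_haarUnitary]
  rw [Finset.sum_const, ← Finset.mul_sum, Finset.sum_comm, ← sqNorm, Finset.card_univ, nsmul_eq_mul,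
    Fintype.card_fin, Fintype.card_fin]
  ring

theorem dustmInput_isometry (M : ℕ) : ∀ᵐ Φ ∂dustmInput M, Φ.conjTranspose * Φ = 1 := by
  refine (ae_map_iff (measurable_dustm M).aemeasurable measurableSet_isometry).2
    (ae_of_all _ fun U => ?_)
  have hU := Matrix.mem_unitaryGroup_iff'.1 U.2
  rw [Matrix.star_eq_conjTranspose] at hU
  rw [Matrix.conjTranspose_smul, Matrix.conjTranspose_fromRows_eq_fromCols_conjTranspose,
    Matrix.smul_mul, Matrix.mul_smul, Matrix.fromCols_mul_fromRows, hU, smul_smul,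
    Matrix.conjTranspose_one, Matrix.one_mul, ← two_smul ℂ (1 : Matrix (Fin M) (Fin M) ℂ), smul_smul]
  have : star (((Real.sqrt 2)⁻¹ : ℝ) : ℂ) * (((Real.sqrt 2)⁻¹ : ℝ) : ℂ) * 2 = 1 := by
    rw [Complex.star_def, Complex.conj_ofReal, ← Complex.ofReal_mul, ← mul_inv,
      Real.mul_self_sqrt (by norm_num)]
    push_cast
    norm_num
  rw [this, one_smul]

/-- Expanding `|x₁ + Uᴴx₂|²/2` leaves `(|x₁|² + |x₂|²)/2` and a cross term odd in `U`. The latter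
vanishes by invariance under `U ↦ -U`. -/
theorem integral_sqNorm_dustmInput {M N : ℕ} (hM : 1 ≤ M)
    (x : Matrix (Fin M ⊕ Fin M) (Fin N) ℂ) :
    ∫ Φ, sqNorm (Φ.conjTranspose * x) ∂dustmInput M =
      Fintype.card (Fin M) / Fintype.card (Fin M ⊕ Fin M) * sqNorm x := by
  rw [dustmInput, integral_map (measurable_dustm M).aemeasurable
    (measurable_sqNorm_conjTranspose_mul_left x).aestronglyMeasurable]
  obtain ⟨x₁, x₂, rfl⟩ : ∃ x₁ x₂ : Matrix (Fin M) (Fin N) ℂ, x = Matrix.fromRows x₁ x₂ :=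
    ⟨x.toRows₁, x.toRows₂, (Matrix.fromRows_toRows x).symm⟩
  have hrows : sqNorm (Matrix.fromRows x₁ x₂) = sqNorm x₁ + sqNorm x₂ := by
    simp [sqNorm, Fintype.sum_sum_type]
  have hexp : ∀ U : Matrix.unitaryGroup (Fin M) ℂ,
      sqNorm (((((Real.sqrt 2)⁻¹ : ℝ) : ℂ) • Matrix.fromRows (1 : Matrix (Fin M) (Fin M) ℂ)
        (U : Matrix (Fin M) (Fin M) ℂ)).conjTranspose * Matrix.fromRows x₁ x₂) =
      2⁻¹ * (sqNorm x₁ + sqNorm x₂) +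
        reInner x₁ ((U : Matrix (Fin M) (Fin M) ℂ).conjTranspose * x₂) := by
    intro U
    have hU := Matrix.mem_unitaryGroup_iff.1 U.2
    rw [Matrix.star_eq_conjTranspose] at hU
    rw [Matrix.conjTranspose_smul, Matrix.conjTranspose_fromRows_eq_fromCols_conjTranspose,
      Matrix.smul_mul, Matrix.fromCols_mul_fromRows, Complex.star_def, Complex.conj_ofReal,
      sqNorm_smul, sqNorm_add, Matrix.conjTranspose_one, Matrix.one_mul, inv_pow,
      Real.sq_sqrt (by norm_num), sqNorm_mul_of_isometry (by rwa [Matrix.conjTranspose_conjTranspose])]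
    ring
  have hcont : Continuous fun U : Matrix.unitaryGroup (Fin M) ℂ =>
      reInner x₁ ((U : Matrix (Fin M) (Fin M) ℂ).conjTranspose * x₂) := by
    have : Continuous fun U : Matrix.unitaryGroup (Fin M) ℂ =>
        (U : Matrix (Fin M) (Fin M) ℂ).conjTranspose * x₂ :=
      continuous_subtype_val.matrix_conjTranspose.matrix_mul continuous_const
    exact continuous_finsetSum _ fun i _ => continuous_finsetSum _ fun j _ =>
      continuous_const.inner (this.matrix_elem i j)
  have hzero : ∫ U, reInner x₁ ((U : Matrix (Fin M) (Fin M) ℂ).conjTranspose * x₂)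
      ∂haarUnitary M = 0 := by
    have key := integral_mul_left_eq_self (μ := haarUnitary M)
      (fun U : Matrix.unitaryGroup (Fin M) ℂ =>
        reInner x₁ ((U : Matrix (Fin M) (Fin M) ℂ).conjTranspose * x₂)) (-1)
    have hneg : ∀ U : Matrix.unitaryGroup (Fin M) ℂ,
        ((-1 * U : Matrix.unitaryGroup (Fin M) ℂ) : Matrix (Fin M) (Fin M) ℂ) =
          -(U : Matrix (Fin M) (Fin M) ℂ) := fun U => by rw [neg_one_mul]; rfl
    simp only [hneg, Matrix.conjTranspose_neg, Matrix.neg_mul, reInner_neg_right,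
      integral_neg] at key
    exact self_eq_neg.1 key.symm
  simp_rw [hexp]
  rw [integral_add (integrable_const _) (integrable_haarUnitary hcont), hzero, hrows]
  have : (M : ℝ) ≠ 0 := by positivity
  simp only [integral_const, probReal_univ, one_smul, Fintype.card_sum, Fintype.card_fin]
  push_cast
  field_simp
  ring

end Inputs

/-! ### Expansions of the normalized rates and comparison in `M`. -/

section Rates

theorem log2e_pos : 0 < log2e :=
  Real.logb_pos (by norm_num) (Real.one_lt_exp_iff.2 one_pos)

theorem ustmRate_sub_isBigO {T M N : ℕ} (hM : 1 ≤ M) (hMT : M ≤ T) :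
    (fun ρ : ℝ => ustmRate T M N ρ - ustmLowSNR T M N ρ) =O[𝓝[>] 0] fun ρ : ℝ => ρ ^ 4 := by
  have : Nonempty (Fin M) := ⟨⟨0, hM⟩⟩
  have : Nonempty (Fin T) := ⟨⟨0, hM.trans hMT⟩⟩
  have hM0 : (0 : ℝ) < M := by exact_mod_cast hM
  have hT0 : (0 : ℝ) < T := by exact_mod_cast hM.trans hMT
  obtain ⟨C, hC⟩ := abs_mutualInfo_sub_le (ν := Fin N) (ustmInput_isometry hMT)
    (integral_sqNorm_ustmInput hMT)
  simp only [Fintype.card_fin] at hC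
  -- The factor `(T/M)⁴` converts `s⁴` into `ρ⁴`; the range `ρ < M/(16T)` chosen next is `s < 1/16`.
  refine IsBigO.of_bound (C * (T / M) ^ 4 * (log2e / T)) ?_
  filter_upwards [Ioo_mem_nhdsGT (by positivity : 0 < (M : ℝ) / (16 * T))] with ρ hρ
  have hs : ρ * T / M ≤ 1 / 16 := by
    have := hρ.2.le
    rw [le_div_iff₀ (by positivity)] at this
    rw [div_le_iff₀ hM0]
    linarith
  have h := hC ρ _ hρ.1 rfl hs
  have e : ustmRate T M N ρ - ustmLowSNR T M N ρ =
      (((mutualInfo (jointLaw (ν := Fin N) ρ (ustmInput T M))).toReal -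
        M * N * ((ρ * T / M) ^ 2 / 2 * (1 - M / T) - (ρ * T / M) ^ 3 / 3 * (1 - (M / T) ^ 2)))) *
        (log2e / T) := by
    rw [ustmRate, ustmLowSNR, ustmInfo]
    field_simp
    ring
  have hl : 0 < log2e / T := div_pos log2e_pos hT0
  rw [e, norm_mul, Real.norm_eq_abs, Real.norm_of_nonneg hl.le,
    Real.norm_of_nonneg (by positivity : 0 ≤ ρ ^ 4)]
  refine (mul_le_mul_of_nonneg_right h hl.le).trans_eq ?_
  ring

theorem dustmRate_sub_isBigO {M N : ℕ} (hM : 1 ≤ M) :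
    (fun ρ : ℝ => dustmRate M N ρ - 2 * ustmLowSNR (2 * M) M N ρ)
      =O[𝓝[>] 0] fun ρ : ℝ => ρ ^ 4 := by
  have : Nonempty (Fin M) := ⟨⟨0, hM⟩⟩
  have hM0 : (0 : ℝ) < M := by exact_mod_cast hM
  obtain ⟨C, hC⟩ := abs_mutualInfo_sub_le (ν := Fin N) (dustmInput_isometry M)
    (integral_sqNorm_dustmInput hM)
  simp only [Fintype.card_sum, Fintype.card_fin, Nat.cast_add] at hC
  refine IsBigO.of_bound (C * 2 ^ 4 * (log2e / M)) ?_
  filter_upwards [Ioo_mem_nhdsGT (by norm_num : (0 : ℝ) < 1 / 32)] with ρ hρ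
  -- For the differential input `s = 2ρ` and `κ = 1/2`.
  have h2 : ρ * (M + M) / M = 2 * ρ := by field_simp; ring
  have h3 : (M : ℝ) / (M + M) = 1 / 2 := by field_simp; ring
  have h := hC ρ (2 * ρ) hρ.1 h2.symm (by linarith [hρ.2])
  rw [h3] at h
  have e : dustmRate M N ρ - 2 * ustmLowSNR (2 * M) M N ρ =
      (((mutualInfo (jointLaw (ν := Fin N) ρ (dustmInput M))).toReal -
        M * N * ((2 * ρ) ^ 2 / 2 * (1 - 1 / 2) - (2 * ρ) ^ 3 / 3 * (1 - (1 / 2) ^ 2)))) *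
        (log2e / M) := by
    rw [dustmRate, ustmLowSNR, dustmInfo]
    push_cast
    field_simp
    ring
  have hl : 0 < log2e / M := div_pos log2e_pos hM0
  rw [e, norm_mul, Real.norm_eq_abs, Real.norm_of_nonneg hl.le,
    Real.norm_of_nonneg (by positivity : 0 ≤ ρ ^ 4)]
  refine (mul_le_mul_of_nonneg_right h hl.le).trans_eq ?_
  ring

theorem eventually_ustmRate_lt {T M M' N : ℕ} (hM : 1 ≤ M) (hMM' : M < M') (hMT : M' ≤ T)
    (hN : 1 ≤ N) : ∀ᶠ ρ : ℝ in 𝓝[>] 0, ustmRate T M' N ρ < ustmRate T M N ρ := by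
  have hM0 : (0 : ℝ) < M := by exact_mod_cast hM
  have hlt : (M : ℝ) < M' := by exact_mod_cast hMM'
  have hM0' : (0 : ℝ) < M' := hM0.trans hlt
  have hT0 : (0 : ℝ) < T := hM0'.trans_le (by exact_mod_cast hMT)
  have hN0 : (0 : ℝ) < N := by exact_mod_cast hN
  -- The quadratic coefficient is `(NT/(2M) - N/2) log₂ e`, and `δ` is its drop from `M` to `M'`.
  -- Everything else in the rate difference is `o(ρ²)`, hence eventually at most `δρ²/2` in absolute
  -- value.
  obtain ⟨δ, hδ⟩ : ∃ δ : ℝ, δ = N * T / 2 * (1 / M - 1 / M') * log2e := ⟨_, rfl⟩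
  have hδ0 : 0 < δ := by
    have : 0 < (1 : ℝ) / M - 1 / M' := sub_pos.2 (one_div_lt_one_div_of_lt hM0 hlt)
    rw [hδ]
    exact mul_pos (mul_pos (by positivity) this) log2e_pos
  have h43 : (fun ρ : ℝ => ρ ^ 4) =o[𝓝[>] 0] fun ρ : ℝ => ρ ^ 2 :=
    (isLittleO_pow_pow (by norm_num)).mono nhdsWithin_le_nhds
  have h32 : (fun ρ : ℝ => ρ ^ 3) =o[𝓝[>] 0] fun ρ : ℝ => ρ ^ 2 :=
    (isLittleO_pow_pow (by norm_num)).mono nhdsWithin_le_nhds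
  have h1 := (ustmRate_sub_isBigO (N := N) hM (hMM'.le.trans hMT)).trans_isLittleO h43
  have h2 := (ustmRate_sub_isBigO (N := N) (hM.trans hMM'.le) hMT).trans_isLittleO h43
  obtain ⟨b, hb⟩ : ∃ b : ℝ, ∀ ρ, ustmLowSNR T M N ρ - ustmLowSNR T M' N ρ - δ * ρ ^ 2 =
      b * ρ ^ 3 := by
    refine ⟨(-(N / (2 * M) * (T - M) * (2 * T / (3 * M) * (1 + M / T))) +
      N / (2 * M') * (T - M') * (2 * T / (3 * M') * (1 + M' / T))) * log2e, fun ρ => ?_⟩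
    rw [ustmLowSNR, ustmLowSNR, hδ]
    field_simp
    ring
  have h3 := ((h1.sub h2).add (h32.const_mul_left b)).def (half_pos hδ0)
  filter_upwards [h3, self_mem_nhdsWithin] with ρ hρ hpos
  have hpos' : 0 < ρ ^ 2 := pow_pos hpos 2
  rw [← hb, Real.norm_eq_abs, Real.norm_of_nonneg hpos'.le] at hρ
  have := (abs_le.1 hρ).1
  nlinarith [mul_pos hδ0 hpos']

end Rates

end USTM

theorem mainTheorem3 :
    -- all mutual informations are finite
    (∀ T M N : ℕ, 1 ≤ M → M ≤ T → 1 ≤ N → ∀ ρ : ℝ, 0 < ρ → USTM.ustmInfo T M N ρ ≠ ⊤) ∧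
    (∀ M N : ℕ, 1 ≤ M → 1 ≤ N → ∀ ρ : ℝ, 0 < ρ → USTM.dustmInfo M N ρ ≠ ⊤) ∧
    -- the expansion for USTM, through order three
    (∀ T M N : ℕ, 1 ≤ M → M ≤ T → 1 ≤ N →
      (fun ρ : ℝ => USTM.ustmRate T M N ρ - USTM.ustmLowSNR T M N ρ)
        =O[𝓝[>] 0] fun ρ : ℝ => ρ ^ 4) ∧
    -- its form for `T = 2 M`
    (∀ M N : ℕ, 1 ≤ M → 1 ≤ N → ∀ ρ : ℝ,
      USTM.ustmLowSNR (2 * M) M N ρ = ρ ^ 2 * (N : ℝ) / 2 * (1 - 2 * ρ) * USTM.log2e) ∧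
    -- DUSTM has twice the rate of USTM with `T = 2 M`, through order three
    (∀ M N : ℕ, 1 ≤ M → 1 ≤ N →
      (fun ρ : ℝ => USTM.dustmRate M N ρ - 2 * USTM.ustmRate (2 * M) M N ρ)
        =O[𝓝[>] 0] fun ρ : ℝ => ρ ^ 4) ∧
    -- at low SNR the USTM rate is strictly decreasing in `M`, and `M = 1` is the unique optimum
    (∀ T N : ℕ, 1 ≤ T → 1 ≤ N → ∀ᶠ ρ : ℝ in 𝓝[>] 0,
      StrictAntiOn (fun M : ℕ => USTM.ustmRate T M N ρ) (Set.Icc 1 T) ∧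
      ∀ M : ℕ, 1 < M → M ≤ T → USTM.ustmRate T M N ρ < USTM.ustmRate T 1 N ρ) := by
  refine ⟨fun T M N hM hMT _ ρ hρ => ?_, fun M N hM _ ρ hρ => ?_,
    fun T M N hM hMT _ => USTM.ustmRate_sub_isBigO hM hMT, fun M N hM _ ρ => ?_,
    fun M N hM _ => ?_, fun T N hT hN => ?_⟩
  · have : Nonempty (Fin M) := ⟨⟨0, hM⟩⟩
    have : Nonempty (Fin T) := ⟨⟨0, hM.trans hMT⟩⟩
    exact (USTM.mutualInfo_jointLaw (ν := Fin N) (USTM.ustmInput_isometry hMT) hρ rfl).1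
  · have : Nonempty (Fin M) := ⟨⟨0, hM⟩⟩
    exact (USTM.mutualInfo_jointLaw (ν := Fin N) (USTM.dustmInput_isometry M) hρ rfl).1
  · have hM0 : (M : ℝ) ≠ 0 := by positivity
    rw [USTM.ustmLowSNR]
    push_cast
    field_simp
    ring
  -- Both rates are compared with the same explicit polynomial, which cancels.
  · have h := (USTM.dustmRate_sub_isBigO (N := N) hM).sub
      ((USTM.ustmRate_sub_isBigO (T := 2 * M) (N := N) hM (by omega)).const_mul_left 2)
    refine h.congr_left fun ρ => ?_
    ring
  -- Only finitely many pairs `M < M'` occur, so one threshold on `ρ` serves them all.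
  · have hall : ∀ᶠ ρ : ℝ in 𝓝[>] 0, ∀ M ∈ Set.Icc 1 T, ∀ M' ∈ Set.Icc 1 T, M < M' →
        USTM.ustmRate T M' N ρ < USTM.ustmRate T M N ρ := by
      refine (eventually_all_finite (Set.finite_Icc 1 T)).2 fun M hM =>
        (eventually_all_finite (Set.finite_Icc 1 T)).2 fun M' hM' => ?_
      by_cases hlt : M < M'
      · filter_upwards [USTM.eventually_ustmRate_lt hM.1 hlt hM'.2 hN] with ρ hρ _ using hρ
      · exact Eventually.of_forall fun ρ h => absurd h hlt
    filter_upwards [hall] with ρ hρ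
    exact ⟨fun M hM M' hM' hlt => hρ M hM M' hM' hlt,
      fun M hM hMT => hρ 1 ⟨le_rfl, hT⟩ M ⟨hM.le, hMT⟩ hM⟩
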